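/- Let $\{\xi(m)\}_{m\in\mathbb Z}$ and $\{\eta(m)\}_{m\in\mathbb Z}$ be mutually uncorrelated mean-zero wide-sense stationary sequences of complex random variables with finite second moments and spectral densities $f,g\ge 0$, i.e. $\mathsf E\,\xi(m)\overline{\xi(k)}=\frac1{2\pi}\int_{-\pi}^{\pi}e^{i(m-k)\lambda}f(\lambda)\,d\lambda$ and likewise for $\eta$ with $g$; assume the minimality condition $\int_{-\pi}^{\pi}\frac{d\lambda}{f(\lambda)+g(\lambda)}<\infty$. For integers $k,j$ put $$R_{k,j}=\frac1{2\pi}\int_{-\pi}^{\pi}\frac{e^{-i\lambda(j+k)}f}{f+g}\,d\lambda,\qquad P_{k,j}=\frac1{2\pi}\int_{-\pi}^{\pi}\frac{e^{i\lambda(j-k)}}{f+g}\,d\lambda,\qquad Q_{k,j}=\frac1{2\pi}\int_{-\pi}^{\pi}\frac{e^{i\lambda(j-k)}fg}{f+g}\,d\lambda .$$ Let $\mathbf P$ be the linear operator in $\ell_2$ given by the matrix $(P_{l,k})_{l,k\ge0}$, on its natural domain: the $c\in\ell_2$ such that $\frac{C}{f+g}$ is integrable, where $C(\lambda)=\sum_{k\ge0}c(k)e^{i\lambda(k+1)}$,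 and such that the sequence $(\mathbf Pc)_l=\frac1{2\pi}\int_{-\pi}^{\pi}e^{-i\lambda(l+1)}\frac{C(\lambda)}{f+g}\,d\lambda$, $l\ge0$, is in $\ell_2$. Let $p\le0$ and $\mathbf r_p=(R_{1,-p},R_{2,-p},\ldots)\in\ell_2$. Then: (a) $\mathbf P$ is injective, so that $\mathbf P^{-1}$ is defined on the range of $\mathbf P$; if $f+g$ is essentially bounded, then $\mathbf r_p$ is in the range of $\mathbf P$. (b) Suppose that $\mathbf P^{-1}\mathbf r_p\in\ell_2$ exists, i.e. that $\mathbf r_p$ is in the range of $\mathbf P$. Then the mean-square optimal linear estimate $\widehat\xi(p)$ of $\xi(p)$ from the observations $\xi(m)+\eta(m)$, $m\le0$ (the element of the closed linear span of these observations in $L_2(\Omega)$ with least mean-square distance to $\xi(p)$) exists, is unique, and equals $$\widehat\xi(p)=\int_{-\pi}^{\pi}\varphi_p(\lambda)\,dZ_{\xi+\eta}(\lambda),\qquad \varphi_p(\lambda)=e^{i\lambda p}\frac{f(\lambda)}{f(\lambda)+g(\lambda)}-\frac{\sum_{k\ge0}(\mathbf P^{-1}\mathbf r_p)_k\,e^{i\lambda(k+1)}}{f(\lambda)+g(\lambda)},$$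 where $\int\cdot\,dZ_{\xi+\eta}$ is the spectral stochastic integral of the sequence $\xi+\eta$, i.e. the isometry of $L_2\big(\tfrac{1}{2\pi}(f+g)\,d\lambda\big)$ into $L_2(\Omega)$ with $e^{im\lambda}\mapsto\xi(m)+\eta(m)$. Its mean-square error is $$\mathsf E|\xi(p)-\widehat\xi(p)|^2=\frac1{2\pi}\int_{-\pi}^{\pi}\frac{\big|e^{i\lambda p}g+C_p\big|^2}{(f+g)^2}f\,d\lambda+\frac1{2\pi}\int_{-\pi}^{\pi}\frac{\big|e^{i\lambda p}f-C_p\big|^2}{(f+g)^2}g\,d\lambda=\langle\mathbf r_p,\mathbf P^{-1}\mathbf r_p\rangle+Q_{-p,-p},$$ where $C_p(\lambda)=\sum_{k\ge0}(\mathbf P^{-1}\mathbf r_p)_k\,e^{i\lambda(k+1)}$ and $\langle x,y\rangle=\sum_{k\ge0}x_k\overline{y_k}$. (c) Suppose that $f+g$ admits the canonical factorization $\frac1{f+g}=\big|\sum_{k\ge0}\psi(k)e^{-i\lambda k}\big|^2=\big|\sum_{k\ge0}\theta(k)e^{-i\lambda k}\big|^{-2}$ almost everywhere, where $\psi,\theta\in\ell_2$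 and $\sum_{k\ge0}\psi(k)z^k\cdot\sum_{k\ge0}\theta(k)z^k=1$ for $|z|<1$. Let $\Theta$ be the lower triangular matrix with $\Theta_{k,j}=\theta(k-j)$ for $0\le j\le k$ and $\Theta_{k,j}=0$ for $k<j$. Then $\mathbf P^{-1}=\overline\Theta\,\Theta'$, i.e. for $x,y\in\ell_2$: $x$ is in the range of $\mathbf P$ and $\mathbf P^{-1}x=y$ if and only if $\Theta'x\in\ell_2$ and $\overline\Theta(\Theta'x)=y$ (here $'$ is the transpose). -/

import Mathlib

open MeasureTheory Filter Topology AddCircle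
open scoped ENNReal ComplexConjugate Real

noncomputable section

namespace NoisyFilter

instance fact_two_pi_pos : Fact (0 < 2 * π) := ⟨Real.two_pi_pos⟩

/-- The circle `ℝ / 2πℤ`: functions of the frequency `λ ∈ [-π, π)` are functions on it, and
`fourier n λ = e^{inλ}`. -/
abbrev Freq : Type := AddCircle (2 * π)

/-- The normalised measure `dλ / 2π`. -/
abbrev dm : Measure Freq := haarAddCircle

/-- The Hilbert space `ℓ₂` of complex sequences indexed by `k = 0, 1, 2, …`. -/
abbrev Ell2 : Type := lp (fun _ : ℕ => ℂ) 2

/-! ### Stationary sequences, observations, estimates -/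

section Probability

variable {Ω : Type*} [MeasurableSpace Ω] (μ : Measure Ω)

/-- `f` is a spectral density: integrable and non-negative. -/
structure IsSpectralDensity (f : Freq → ℝ) : Prop where
  integrable : Integrable f dm
  nonneg : 0 ≤ᵐ[dm] f

/-- `ξ` is a (wide-sense) stationary sequence of mean-zero random variables with finite second
moments and with spectral density `f`:
`E ξ(m) conj ξ(k) = (1/2π) ∫ e^{i(m-k)λ} f(λ) dλ`. -/
structure IsStationaryWithDensity (ξ : ℤ → Lp ℂ 2 μ) (f : Freq → ℝ) : Prop where
  density : IsSpectralDensity f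
  mean_zero : ∀ m, ∫ ω, ξ m ω ∂μ = 0
  cov : ∀ m k, ∫ ω, ξ m ω * conj (ξ k ω) ∂μ = ∫ t, fourier (m - k) t * (f t : ℂ) ∂dm

/-- The two (mean-zero) sequences are uncorrelated. -/
def Uncorrelated (ξ η : ℤ → Lp ℂ 2 μ) : Prop :=
  ∀ m k, ∫ ω, ξ m ω * conj (η k ω) ∂μ = 0

/-- The mean-square error `E |X - Y|²`. -/
def mse (X Y : Lp ℂ 2 μ) : ℝ := ∫ ω, ‖X ω - Y ω‖ ^ 2 ∂μ

/-- The closed linear span of `ζ(m)`, `m = 0, -1, -2, …`, in `L₂(Ω)`. -/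
def pastSpace (ζ : ℤ → Lp ℂ 2 μ) : Submodule ℂ (Lp ℂ 2 μ) :=
  (Submodule.span ℂ (ζ '' {m : ℤ | m ≤ 0})).topologicalClosure

/-- `Y` is a mean-square optimal linear estimate of `X` from the observations `ζ(m)`, `m ≤ 0`. -/
def IsOptimalEstimate (ζ : ℤ → Lp ℂ 2 μ) (X Y : Lp ℂ 2 μ) : Prop :=
  Y ∈ pastSpace μ ζ ∧ ∀ Y' ∈ pastSpace μ ζ, mse μ X Y ≤ mse μ X Y'

/-- The measure `F(λ) dλ / 2π`. -/
def spectralMeasure (F : Freq → ℝ) : Measure Freq :=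
  dm.withDensity fun t => ENNReal.ofReal (F t)

/-- The trigonometric polynomial `∑ₘ q(m) e^{imλ}`. -/
def trigPoly (q : ℤ →₀ ℂ) (t : Freq) : ℂ := q.sum fun m a => a * fourier m t

/-- `Y = ∫ φ dZ_ζ` for a stationary sequence `ζ` with spectral density `F` and spectral
representation `ζ(m) = ∫ e^{imλ} dZ_ζ(λ)`. The integral is the isometry from
`L₂(F dλ / 2π)` into `L₂(Ω)` with `e^{imλ} ↦ ζ(m)`: `Y` is the mean-square limit of
`∑ₘ qₙ(m) ζ(m)` for trigonometric polynomials `qₙ` that converge to `φ` in `L₂(F dλ / 2π)`. -/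
def IsSpectralIntegral (ζ : ℤ → Lp ℂ 2 μ) (F : Freq → ℝ) (φ : Freq → ℂ) (Y : Lp ℂ 2 μ) : Prop :=
  MemLp φ 2 (spectralMeasure F) ∧
  ∃ q : ℕ → ℤ →₀ ℂ,
    Tendsto (fun n => eLpNorm (fun t => trigPoly (q n) t - φ t) 2 (spectralMeasure F))
      atTop (𝓝 0) ∧
    Tendsto (fun n => (q n).sum fun m a => a • ζ m) atTop (𝓝 Y)

end Probability

/-- The minimality condition `∫ (f + g)⁻¹ dλ < ∞`, where `0⁻¹ = ∞`. -/
def Minimality (f g : Freq → ℝ) : Prop :=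
  ∫⁻ t, (ENNReal.ofReal (f t + g t))⁻¹ ∂dm < ∞

/-! ### Fourier coefficients -/

/-- `R_{k,j} = (1/2π) ∫ e^{-iλ(j+k)} f/(f+g) dλ`. -/
def coefR (f g : Freq → ℝ) (k j : ℤ) : ℂ :=
  ∫ t, fourier (-(j + k)) t * ((f t / (f t + g t) : ℝ) : ℂ) ∂dm

/-- `P_{k,j} = (1/2π) ∫ e^{iλ(j-k)} 1/(f+g) dλ`. -/
def coefP (f g : Freq → ℝ) (k j : ℤ) : ℂ :=
  ∫ t, fourier (j - k) t * ((1 / (f t + g t) : ℝ) : ℂ) ∂dm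

/-- `Q_{k,j} = (1/2π) ∫ e^{iλ(j-k)} fg/(f+g) dλ`. -/
def coefQ (f g : Freq → ℝ) (k j : ℤ) : ℂ :=
  ∫ t, fourier (j - k) t * ((f t * g t / (f t + g t) : ℝ) : ℂ) ∂dm

/-! ### Square-summable trigonometric series -/

/-- The sum in `L₂(dλ / 2π)` of `∑ₖ c(k) e^{i n(k) λ}` for `c ∈ ℓ₂` and an injective `n`. -/
def expSeries (n : ℕ → ℤ) (hn : Function.Injective n) : Ell2 →ₗᵢ[ℂ] Lp ℂ 2 dm :=
  (orthonormal_fourier.comp n hn).orthogonalFamily.linearIsometry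

theorem hasSum_expSeries (n : ℕ → ℤ) (hn : Function.Injective n) (c : Ell2) :
    HasSum (fun k => c k • (fourierLp 2 (n k) : Lp ℂ 2 dm)) (expSeries n hn c) :=
  (orthonormal_fourier.comp n hn).orthogonalFamily.hasSum_linearIsometry c

theorem inj_succ : Function.Injective fun k : ℕ => (k : ℤ) + 1 := by
  intro a b h; simpa using h

theorem inj_neg : Function.Injective fun k : ℕ => -(k : ℤ) := by
  intro a b h; simpa using h

/-- `∑_{k ≥ 0} c(k) e^{iλ(k+1)}`. -/
def futureSeries : Ell2 →ₗᵢ[ℂ] Lp ℂ 2 dm := expSeries (fun k => (k : ℤ) + 1) inj_succ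

/-- `∑_{k ≥ 0} c(k) e^{-iλk}`. -/
def pastSeries : Ell2 →ₗᵢ[ℂ] Lp ℂ 2 dm := expSeries (fun k => -(k : ℤ)) inj_neg

/-! ### The operator `P` in `ℓ₂` and the vector `r_p` -/

theorem futureSeries_add_ae (c d : Ell2) :
    ⇑(futureSeries (c + d)) =ᵐ[dm] fun t => futureSeries c t + futureSeries d t := by
  rw [map_add]; exact Lp.coeFn_add _ _

theorem futureSeries_smul_ae (a : ℂ) (c : Ell2) :
    ⇑(futureSeries (a • c)) =ᵐ[dm] fun t => a * futureSeries c t := by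
  rw [map_smul]; exact Lp.coeFn_smul _ _

/-- `l ↦ (1/2π) ∫ e^{-iλ(l+1)} (∑ₖ c(k) e^{iλ(k+1)}) / (f+g) dλ`, which is the sequence
`l ↦ ∑ₖ P_{l,k} c(k)`, see `actP_eq_tsum` and `actP_single`. -/
def actP (f g : Freq → ℝ) (c : Ell2) (l : ℕ) : ℂ :=
  fourierCoeff (fun t => futureSeries c t * ((1 / (f t + g t) : ℝ) : ℂ)) ((l : ℤ) + 1)

theorem integrable_add_series {w : Freq → ℂ} {c d : Ell2}
    (hc : Integrable (fun t => futureSeries c t * w t) dm)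
    (hd : Integrable (fun t => futureSeries d t * w t) dm) :
    Integrable (fun t => futureSeries (c + d) t * w t) dm := by
  refine (hc.add hd).congr ?_
  filter_upwards [futureSeries_add_ae c d] with t ht
  simp only [Pi.add_apply, ht]; ring

theorem integrable_smul_series {w : Freq → ℂ} (a : ℂ) {c : Ell2}
    (hc : Integrable (fun t => futureSeries c t * w t) dm) :
    Integrable (fun t => futureSeries (a • c) t * w t) dm := by
  refine (hc.const_mul a).congr ?_
  filter_upwards [futureSeries_smul_ae a c] with t ht
  rw [ht]; ring

theorem actP_add {f g : Freq → ℝ} {c d : Ell2}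
    (hc : Integrable (fun t => futureSeries c t * ((1 / (f t + g t) : ℝ) : ℂ)) dm)
    (hd : Integrable (fun t => futureSeries d t * ((1 / (f t + g t) : ℝ) : ℂ)) dm) :
    actP f g (c + d) = actP f g c + actP f g d := by
  funext l
  have h := congrFun (fourierCoeff.add hc hd) ((l : ℤ) + 1)
  simp only [Pi.add_apply] at h ⊢
  unfold actP
  rw [← h]
  refine congrFun (fourierCoeff_congr_ae ?_) _
  filter_upwards [futureSeries_add_ae c d] with t ht
  simp only [Pi.add_apply, ht]; ring

theorem actP_smul (f g : Freq → ℝ) (a : ℂ) (c : Ell2) :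
    actP f g (a • c) = a • actP f g c := by
  funext l
  simp only [Pi.smul_apply, smul_eq_mul]
  unfold actP
  rw [← fourierCoeff.const_mul]
  refine congrFun (fourierCoeff_congr_ae ?_) _
  filter_upwards [futureSeries_smul_ae a c] with t ht
  rw [ht]; ring

theorem actP_zero (f g : Freq → ℝ) : actP f g 0 = 0 := by
  simpa using actP_smul f g 0 0

/-- The linear operator `P` in `ℓ₂` with matrix `(P_{l,k})`, `l, k ≥ 0`, on its natural domain: the
`c ∈ ℓ₂` for which `(∑ₖ c(k) e^{iλ(k+1)}) / (f+g)` is integrable and `P c ∈ ℓ₂`. -/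
def opP (f g : Freq → ℝ) : Ell2 →ₗ.[ℂ] Ell2 where
  domain :=
    { carrier := {c | Integrable
          (fun t => futureSeries c t * ((1 / (f t + g t) : ℝ) : ℂ)) dm ∧
          Memℓp (actP f g c) 2}
      zero_mem' := by
        refine ⟨?_, by rw [actP_zero]; exact zero_memℓp⟩
        refine (integrable_zero Freq ℂ dm).congr ?_
        filter_upwards [Lp.coeFn_zero ℂ 2 dm] with t ht
        rw [map_zero, ht]
        simp
      add_mem' := by
        rintro c d ⟨hc, hc'⟩ ⟨hd, hd'⟩
        exact ⟨integrable_add_series hc hd, by rw [actP_add hc hd]; exact hc'.add hd'⟩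
      smul_mem' := by
        rintro a c ⟨hc, hc'⟩
        exact ⟨integrable_smul_series a hc, by rw [actP_smul]; exact hc'.const_smul a⟩ }
  toFun :=
    { toFun := fun c => ⟨actP f g c, c.2.2⟩
      map_add' := fun c d => Subtype.ext (actP_add c.2.1 d.2.1)
      map_smul' := fun a c => Subtype.ext (actP_smul f g a c) }

theorem actP_single (f g : Freq → ℝ) (k l : ℕ) :
    actP f g (lp.single 2 k 1) l = coefP f g l k := by
  have h1 : futureSeries (lp.single 2 k 1) = (fourierLp 2 ((k : ℤ) + 1) : Lp ℂ 2 dm) := by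
    unfold futureSeries expSeries
    rw [OrthogonalFamily.linearIsometry_apply_single]
    simp
  unfold actP coefP fourierCoeff
  refine integral_congr_ae ?_
  filter_upwards [coeFn_fourierLp (T := 2 * π) 2 ((k : ℤ) + 1)] with t ht
  rw [h1, ht, smul_eq_mul, ← mul_assoc, ← fourier_add]
  congr 3; ring

theorem actP_eq_tsum (f g : Freq → ℝ)
    (h : MemLp (fun t => ((1 / (f t + g t) : ℝ) : ℂ)) 2 dm) (c : Ell2) (l : ℕ) :
    actP f g c l = ∑' k : ℕ, coefP f g l k * c k := by
  have hm : MemLp (fun t => fourier ((l : ℤ) + 1) t * ((1 / (f t + g t) : ℝ) : ℂ)) 2 dm := by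
    refine h.mono ((map_continuous _).aestronglyMeasurable.mul h.1) ?_
    filter_upwards with t
    rw [norm_mul, fourier_apply, Circle.norm_coe, one_mul]
  have key : ∀ u : Lp ℂ 2 dm, inner ℂ (hm.toLp _) u =
      ∫ t, fourier (-((l : ℤ) + 1)) t • (u t * ((1 / (f t + g t) : ℝ) : ℂ)) ∂dm := by
    intro u
    rw [L2.inner_def]
    refine integral_congr_ae ?_
    filter_upwards [hm.coeFn_toLp] with t ht
    rw [ht, fourier_neg]
    simp only [RCLike.inner_apply, map_mul, Complex.conj_ofReal, smul_eq_mul]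
    ring
  have hs := (hasSum_expSeries _ inj_succ c).mapL (innerSL ℂ (hm.toLp _))
  have h2 : ∀ k : ℕ, innerSL ℂ (hm.toLp _) (c k • (fourierLp 2 ((k : ℤ) + 1) : Lp ℂ 2 dm)) =
      coefP f g l k * c k := by
    intro k
    rw [map_smul, innerSL_apply_apply, key, smul_eq_mul, mul_comm]
    congr 1
    unfold coefP
    refine integral_congr_ae ?_
    filter_upwards [coeFn_fourierLp (T := 2 * π) 2 ((k : ℤ) + 1)] with t ht
    rw [ht, smul_eq_mul, ← mul_assoc, ← fourier_add]
    congr 3; ring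
  simp only [h2] at hs
  rw [hs.tsum_eq, innerSL_apply_apply, key]
  rfl

theorem memℓp_coefR {f g : Freq → ℝ} (hf : IsSpectralDensity f) (hg : IsSpectralDensity g)
    (p : ℤ) : Memℓp (fun l : ℕ => coefR f g ((l : ℤ) + 1) (-p)) 2 := by
  have hb : MemLp (fun t => ((f t / (f t + g t) : ℝ) : ℂ)) 2 dm := by
    refine MemLp.of_bound ?_ 1 ?_
    · exact (Complex.measurable_ofReal.comp_aemeasurable
        (hf.integrable.aemeasurable.div
          (hf.integrable.aemeasurable.add hg.integrable.aemeasurable))).aestronglyMeasurable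
    · filter_upwards [hf.nonneg, hg.nonneg] with t h1 h2
      simp only [Pi.zero_apply] at h1 h2
      rw [Complex.norm_real, Real.norm_of_nonneg (div_nonneg h1 (add_nonneg h1 h2))]
      exact div_le_one_of_le₀ (by linarith) (add_nonneg h1 h2)
  have h := lp.memℓp (fourierBasis.repr (hb.toLp _))
  have h1 : Summable fun i : ℤ => ‖fourierBasis.repr (hb.toLp _) i‖ ^ (2 : ℝ) := by
    simpa using h.summable (by norm_num)
  have hinj : Function.Injective fun l : ℕ => (-p) + ((l : ℤ) + 1) := by
    intro a b hab; simpa using hab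
  have h2 := h1.comp_injective hinj
  refine memℓp_gen ?_
  simp only [ENNReal.toReal_ofNat]
  refine h2.congr fun l => ?_
  simp only [Function.comp_apply]
  congr 2
  rw [fourierBasis_repr, fourierCoeff_congr_ae hb.coeFn_toLp]
  rfl

/-- The vector `r_p = (R_{1,-p}, R_{2,-p}, …) ∈ ℓ₂`. -/
def vecR {f g : Freq → ℝ} (hf : IsSpectralDensity f) (hg : IsSpectralDensity g) (p : ℤ) : Ell2 :=
  ⟨fun l : ℕ => coefR f g ((l : ℤ) + 1) (-p), memℓp_coefR hf hg p⟩

/-! ### Canonical factorization -/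

/-- `1/F = |∑ ψ(k) e^{-iλk}|² = |∑ θ(k) e^{-iλk}|⁻²` with `ψ, θ ∈ ℓ₂`, where the factorization is
canonical: the power series `∑ ψ(k) zᵏ` and `∑ θ(k) zᵏ` have no zeros in the unit disc and are
reciprocal to each other. -/
structure IsCanonicalFactorization (F : Freq → ℝ) (ψ θ : Ell2) : Prop where
  eq_psi : ∀ᵐ t ∂dm, 1 / F t = ‖pastSeries ψ t‖ ^ 2
  eq_theta : ∀ᵐ t ∂dm, 1 / F t = (‖pastSeries θ t‖ ^ 2)⁻¹
  reciprocal : ∀ z : ℂ, ‖z‖ < 1 → (∑' k : ℕ, ψ k * z ^ k) * (∑' k : ℕ, θ k * z ^ k) = 1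

/-- The lower triangular matrix `Θ_{k,j} = θ(k-j)` for `0 ≤ j ≤ k`, `Θ_{k,j} = 0` for `k < j`. -/
def lowerToeplitz (θ : Ell2) : Matrix ℕ ℕ ℂ := fun k j => if j ≤ k then θ (k - j) else 0

/-- The product of an infinite matrix and a sequence. -/
def matVec (A : Matrix ℕ ℕ ℂ) (x : ℕ → ℂ) (k : ℕ) : ℂ := ∑' j, A k j * x j

/-! ### The spectral characteristic -/

/-- `φ_p = e^{iλp} f/(f+g) - (∑ₖ c(k) e^{iλ(k+1)})/(f+g)`. -/
def specChar (f g : Freq → ℝ) (p : ℤ) (c : Ell2) (t : Freq) : ℂ :=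
  fourier p t * ((f t / (f t + g t) : ℝ) : ℂ) - futureSeries c t / ((f t + g t : ℝ) : ℂ)

end NoisyFilter

end

open NoisyFilter

noncomputable section

namespace NoisyFilter

/-! Write F = f + g, G = e^{iλp} f/F and C = ∑ c(k) e^{iλ(k+1)}. The equation P c = r_p says exactly
that φ = G - C/F has no Fourier coefficient of positive index. On the other side, F φ = e^{iλp} f -
C has at every index m ≤ 0 the same coefficient as e^{iλp} f, namely the covariance of ξ(p) with
ξ(m) + η(m). Hence φ represents the orthogonal projection of ξ(p), provided that φ lies in L₂(F) and
is there a limit of polynomials in e^{imλ}, m ≤ 0.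

The difficulty is that F and 1/F are merely integrable, so products of functions with one-sided
spectrum need care. The device is `exists_seq_multiplier`: functions b_i = 1/(1 + A/(i+1)) with
spectrum in [0, ∞), Re A = a ≥ 0, tending to 1 and taming a given a. It gives
`integral_mul_eq_zero_of_freqGE` and, with Fatou's lemma, the a priori estimate
`integrable_sq_mul_of_fourierCoeff_eq`: if the positive coefficients of C/F are those of an L₂
function, then ∫ |C|²/F is finite and equals the quadratic form of P at c. From this follow the
injectivity of P, φ ∈ L₂(F), and the error formula. The polynomial approximation is a duality
argument (`toLp_mem_closure_span`), and the estimate is carried from L₂(F) to L₂(Ω) because the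
exponentials and the observations have the same Gram matrix.

For bounded F, solving P c = r_p is a least squares problem with weight 1/F (`exists_opP_eq_vecR`).
With a canonical factorization it is a Wiener–Hopf argument (`opP_eq_iff_of_factorization`): 1/F =
|Ψ|² and ΨΘ = 1 split the equation into two triangular ones. -/

/-! ### Fejér means -/

/-- The Fejér mean of order `N` of the Fourier series of `u`. -/
def fejer (N : ℕ) (u : Freq → ℂ) : C(Freq, ℂ) :=
  (N : ℂ)⁻¹ • ∑ j ∈ Finset.range N, ∑ k ∈ Finset.range N,
    fourierCoeff u ((j : ℤ) - k) • fourier ((j : ℤ) - k)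

/-- The Fejér kernel. -/
def fejerKernel (N : ℕ) (t s : Freq) : ℝ :=
  (N : ℝ)⁻¹ * ‖∑ j ∈ Finset.range N, fourier (j : ℤ) t * fourier (-(j : ℤ)) s‖ ^ 2

theorem fejerKernel_nonneg (N : ℕ) (t s : Freq) : 0 ≤ fejerKernel N t s := by
  unfold fejerKernel; positivity

theorem continuous_fejerKernel (N : ℕ) (t : Freq) : Continuous (fejerKernel N t) := by
  unfold fejerKernel; fun_prop

theorem norm_fourier_apply (n : ℤ) (t : Freq) : ‖fourier n t‖ = 1 := by
  rw [fourier_apply, Circle.norm_coe]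

theorem integrable_continuous_mul {v : Freq → ℂ} (hv : Continuous v) {u : Freq → ℂ}
    (hu : Integrable u dm) : Integrable (fun t => v t * u t) dm := by
  obtain ⟨B, hB⟩ := (isCompact_range hv).isBounded.exists_norm_le
  exact hu.bdd_mul hv.aestronglyMeasurable (ae_of_all _ fun t => hB _ ⟨t, rfl⟩)

/-- The double sum over j, k in `fejer` is what makes the kernel a squared modulus. Its positivity
and unit mass then give the bounds below. -/
theorem fejer_eq_integral (N : ℕ) {u : Freq → ℂ} (hu : Integrable u dm) (t : Freq) :
    fejer N u t = ∫ s, (fejerKernel N t s : ℂ) * u s ∂dm := by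
  have h1 : ∀ s, (fejerKernel N t s : ℂ) * u s = (N : ℂ)⁻¹ * ∑ j ∈ Finset.range N,
      ∑ k ∈ Finset.range N, fourier ((j : ℤ) - k) t * (fourier (-((j : ℤ) - k)) s • u s) := by
    intro s
    unfold fejerKernel
    push_cast
    rw [← Complex.mul_conj', mul_assoc, map_sum, Finset.sum_mul_sum, Finset.sum_mul]
    congr 1
    refine Finset.sum_congr rfl fun j _ => ?_
    rw [Finset.sum_mul]
    refine Finset.sum_congr rfl fun k _ => ?_
    rw [map_mul, ← fourier_neg, ← fourier_neg, neg_neg, sub_eq_add_neg, fourier_add,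
      neg_add, neg_neg, fourier_add, smul_eq_mul]
    ring
  simp_rw [h1]
  rw [integral_const_mul, integral_finsetSum]
  · simp only [fejer, ContinuousMap.smul_apply, ContinuousMap.sum_apply, smul_eq_mul]
    congr 1
    refine Finset.sum_congr rfl fun j _ => ?_
    rw [integral_finsetSum]
    · refine Finset.sum_congr rfl fun k _ => ?_
      rw [integral_const_mul, mul_comm]
      rfl
    · exact fun k _ => (hu.fourier_smul _).const_mul _
  · exact fun j _ => integrable_finsetSum _ fun k _ => (hu.fourier_smul _).const_mul _

theorem fourierCoeff_one (n : ℤ) :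
    fourierCoeff (fun _ : Freq => (1 : ℂ)) n = if n = 0 then 1 else 0 := by
  have := congrFun (fourierCoeff_fourier (T := 2 * π) 0) n
  rw [Pi.single_apply] at this
  rw [← this]
  congr 1
  ext t
  simp

theorem integral_fejerKernel {N : ℕ} (hN : N ≠ 0) (t : Freq) :
    ∫ s, fejerKernel N t s ∂dm = 1 := by
  have h := fejer_eq_integral N (integrable_const (1 : ℂ)) t
  simp only [mul_one] at h
  rw [integral_complex_ofReal] at h
  simp only [fejer, fourierCoeff_one, ContinuousMap.smul_apply, ContinuousMap.sum_apply, smul_eq_mul,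
    sub_eq_zero, Nat.cast_inj, ite_mul, one_mul, zero_mul] at h
  have h2 : ∀ j ∈ Finset.range N, ∑ k ∈ Finset.range N,
      (if j = k then fourier ((j : ℤ) - k) t else (0 : ℂ)) = 1 := by
    intro j hj
    rw [Finset.sum_ite_eq, if_pos hj]
    simp
  rw [Finset.sum_congr rfl h2] at h
  simp [hN] at h
  exact_mod_cast h.symm

theorem norm_fejer_le {N : ℕ} (hN : N ≠ 0) {u : Freq → ℂ} (hu : Integrable u dm) {M : ℝ}
    (hM : ∀ᵐ s ∂dm, ‖u s‖ ≤ M) (t : Freq) : ‖fejer N u t‖ ≤ M := by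
  rw [fejer_eq_integral N hu]
  have hi : Integrable (fejerKernel N t) dm :=
    (continuous_fejerKernel N t).integrable_of_hasCompactSupport
      (HasCompactSupport.of_compactSpace _)
  calc ‖∫ s, (fejerKernel N t s : ℂ) * u s ∂dm‖ ≤ ∫ s, fejerKernel N t s * M ∂dm := by
        refine norm_integral_le_of_norm_le (hi.mul_const M) ?_
        filter_upwards [hM] with s hs
        rw [norm_mul, Complex.norm_real, Real.norm_of_nonneg (fejerKernel_nonneg _ _ _)]
        exact mul_le_mul_of_nonneg_left hs (fejerKernel_nonneg _ _ _)
    _ = M := by rw [integral_mul_const, integral_fejerKernel hN, one_mul]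

theorem re_fejer_nonneg (N : ℕ) {u : Freq → ℂ} (hu : Integrable u dm)
    (h : ∀ᵐ s ∂dm, 0 ≤ (u s).re) (t : Freq) : 0 ≤ (fejer N u t).re := by
  have hi : Integrable (fun s => (fejerKernel N t s : ℂ) * u s) dm :=
    integrable_continuous_mul (Complex.continuous_ofReal.comp (continuous_fejerKernel N t)) hu
  have := integral_re (𝕜 := ℂ) hi
  rw [fejer_eq_integral N hu, ← RCLike.re_eq_complex_re, ← this]
  refine integral_nonneg_of_ae ?_
  filter_upwards [h] with s hs
  simpa using mul_nonneg (fejerKernel_nonneg N t s) hs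

/-- Identifies Fejér means with Cesàro means of symmetric partial sums, so that their L₂ convergence
follows from that of the Fourier series. -/
theorem fejer_sum_eq {E : Type*} [AddCommGroup E] (a : ℤ → E) (N : ℕ) :
    ∑ j ∈ Finset.range N, ∑ k ∈ Finset.range N, a ((j : ℤ) - k) =
      ∑ M ∈ Finset.range N, ∑ n ∈ Finset.Icc (-(M : ℤ)) M, a n := by
  induction N with
  | zero => simp
  | succ N ih =>
    rw [Finset.sum_range_succ (fun M : ℕ => ∑ n ∈ Finset.Icc (-(M : ℤ)) M, a n), ← ih,
      Finset.sum_range_succ]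
    simp_rw [Finset.sum_range_succ (fun k : ℕ => a (_ - (k : ℤ))) N]
    rw [Finset.sum_add_distrib, add_assoc]
    congr 1
    -- Passing from N to N + 1 adds the column k = N, with differences -N, …, -1, and the row j = N,
    -- with differences 0, …, N: each index once.
    have h : Finset.Icc (-(N : ℤ)) N = (Finset.range N).image (fun j : ℕ => (j : ℤ) - N) ∪
        (Finset.range (N + 1)).image (fun k : ℕ => (N : ℤ) - k) := by
      ext n
      simp only [Finset.mem_Icc, Finset.mem_union, Finset.mem_image, Finset.mem_range]
      constructor
      · intro hn
        rcases lt_or_ge n 0 with h0 | h0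
        · exact Or.inl ⟨(n + N).toNat, by omega, by omega⟩
        · exact Or.inr ⟨(N - n).toNat, by omega, by omega⟩
      · rintro (⟨j, hj, rfl⟩ | ⟨j, hj, rfl⟩) <;> omega
    rw [h, Finset.sum_union, Finset.sum_image, Finset.sum_image, Finset.sum_range_succ _ N]
    · intro x _ y _ hxy; simpa using hxy
    · intro x _ y _ hxy; simpa using hxy
    · rw [Finset.disjoint_left]
      simp only [Finset.mem_image, Finset.mem_range, not_exists, not_and]
      rintro _ ⟨j, hj, rfl⟩ k hk
      omega

theorem tendsto_fejer_toLp (U : Lp ℂ 2 dm) :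
    Tendsto (fun N => ContinuousMap.toLp 2 dm ℂ (fejer N U)) atTop (𝓝 U) := by
  have h : Tendsto (fun M : ℕ => ∑ n ∈ Finset.Icc (-(M : ℤ)) M,
      fourierCoeff U n • (fourierLp 2 n : Lp ℂ 2 dm)) atTop (𝓝 U) :=
    (hasSum_fourier_series_L2 U).comp Finset.tendsto_Icc_neg
  refine h.cesaro_smul.congr fun N => ?_
  rw [← fejer_sum_eq (fun n => fourierCoeff U n • (fourierLp 2 n : Lp ℂ 2 dm))]
  simp only [fejer, map_smul, map_sum]
  rw [RCLike.real_smul_eq_coe_smul (K := ℂ)]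
  push_cast
  rfl

theorem exists_seq_tendsto_fejer {u : Freq → ℂ} (hu : MemLp u 2 dm) :
    ∃ ns : ℕ → ℕ, (∀ i, ns i ≠ 0) ∧
      ∀ᵐ t ∂dm, Tendsto (fun i => fejer (ns i) u t) atTop (𝓝 (u t)) := by
  have h := tendstoInMeasure_of_tendsto_Lp (tendsto_fejer_toLp (hu.toLp u))
  obtain ⟨ns, h1, h2⟩ := h.exists_seq_tendsto_ae
  -- The shift makes every order positive, as the unit mass of the kernel requires.
  refine ⟨fun i => ns (i + 1), fun i => ?_, ?_⟩
  · exact (lt_of_le_of_lt (Nat.zero_le _) (h1 (Nat.lt_succ_self i))).ne'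
  have h3 : ∀ᵐ t ∂dm, ∀ N, ContinuousMap.toLp 2 dm ℂ (fejer N (hu.toLp u)) t =
      fejer N (hu.toLp u) t := ae_all_iff.2 fun N => ContinuousMap.coeFn_toLp _ _
  filter_upwards [h2, h3, hu.coeFn_toLp] with t ht ht3 ht4
  rw [ht4] at ht
  refine ((tendsto_add_atTop_iff_nat 1).2 ht).congr fun i => ?_
  rw [ht3]
  unfold fejer
  rw [fourierCoeff_congr_ae hu.coeFn_toLp]

/-! ### Integrable functions with one-sided spectrum -/

/-- Parseval for a bounded and an integrable function. The Fejér means of φ stay below M, so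
dominated convergence reduces the claim to trigonometric polynomials. -/
theorem integral_mul_eq_zero {φ h : Freq → ℂ} (hφ : AEStronglyMeasurable φ dm) {M : ℝ}
    (hM : ∀ᵐ t ∂dm, ‖φ t‖ ≤ M) (hh : Integrable h dm)
    (h0 : ∀ n, fourierCoeff φ n = 0 ∨ fourierCoeff h (-n) = 0) : ∫ t, φ t * h t ∂dm = 0 := by
  obtain ⟨ns, hns, hlim⟩ := exists_seq_tendsto_fejer (MemLp.of_bound (p := 2) hφ M hM)
  have hφi : Integrable φ dm := (MemLp.of_bound (p := 1) hφ M hM).integrable le_rfl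
  have h1 : Tendsto (fun i => ∫ t, fejer (ns i) φ t * h t ∂dm) atTop (𝓝 (∫ t, φ t * h t ∂dm)) := by
    refine tendsto_integral_of_dominated_convergence (fun t => M * ‖h t‖)
      (fun i => (map_continuous _).aestronglyMeasurable.mul hh.1) (hh.norm.const_mul M)
      (fun i => ae_of_all _ fun t => ?_) ?_
    · rw [norm_mul]
      exact mul_le_mul_of_nonneg_right (norm_fejer_le (hns i) hφi hM t) (norm_nonneg _)
    · filter_upwards [hlim] with t ht using ht.mul_const _
  refine tendsto_nhds_unique h1 (tendsto_const_nhds.congr fun i => ?_)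
  have h2 : ∀ t, fejer (ns i) φ t * h t = ∑ j ∈ Finset.range (ns i), ∑ k ∈ Finset.range (ns i),
      ((ns i : ℂ)⁻¹ * fourierCoeff φ ((j : ℤ) - k)) * (fourier (-(-((j : ℤ) - k))) t • h t) := by
    intro t
    simp only [fejer, ContinuousMap.smul_apply, ContinuousMap.sum_apply, smul_eq_mul, neg_neg]
    rw [Finset.mul_sum, Finset.sum_mul]
    refine Finset.sum_congr rfl fun j _ => ?_
    rw [Finset.mul_sum, Finset.sum_mul]
    exact Finset.sum_congr rfl fun k _ => by ring
  simp_rw [h2]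
  rw [integral_finsetSum]
  · refine (Finset.sum_eq_zero fun j _ => ?_).symm
    rw [integral_finsetSum]
    · refine Finset.sum_eq_zero fun k _ => ?_
      rw [integral_const_mul]
      change _ * fourierCoeff h (-((j : ℤ) - k)) = 0
      rcases h0 ((j : ℤ) - k) with h3 | h3 <;> rw [h3] <;> simp only [mul_zero, zero_mul]
    · exact fun k _ => (hh.fourier_smul _).const_mul _
  · exact fun j _ => integrable_finsetSum _ fun k _ => (hh.fourier_smul _).const_mul _

theorem fourierCoeff_conj (u : Freq → ℂ) (n : ℤ) :
    fourierCoeff (fun t => conj (u t)) n = conj (fourierCoeff u (-n)) := by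
  unfold fourierCoeff
  rw [← integral_conj]
  refine integral_congr_ae (ae_of_all _ fun t => ?_)
  simp only [smul_eq_mul, map_mul, fourier_neg, neg_neg]

theorem fourierCoeff_fourier_mul (u : Freq → ℂ) (m n : ℤ) :
    fourierCoeff (fun t => fourier m t * u t) n = fourierCoeff u (n - m) := by
  unfold fourierCoeff
  refine integral_congr_ae (ae_of_all _ fun t => ?_)
  simp only [smul_eq_mul]
  rw [← mul_assoc, ← fourier_add]
  congr 3; ring

theorem fourierCoeff_sub {u v : Freq → ℂ} (hu : Integrable u dm) (hv : Integrable v dm) (n : ℤ) :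
    fourierCoeff (fun t => u t - v t) n = fourierCoeff u n - fourierCoeff v n := by
  unfold fourierCoeff
  rw [← integral_sub (hu.fourier_smul _) (hv.fourier_smul _)]
  simp only [smul_sub]

/-- Test u against its own conjugate phase, a bounded function: the integral is the L₁ norm of u,
and it vanishes by `integral_mul_eq_zero`. -/
theorem ae_eq_zero_of_fourierCoeff {u : Freq → ℂ} (hu : Integrable u dm)
    (h : ∀ n, fourierCoeff u n = 0) : u =ᵐ[dm] 0 := by
  obtain ⟨v, hv, huv⟩ := hu.1
  have hm : StronglyMeasurable fun t => conj (v t) / (‖v t‖ : ℂ) :=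
    ((Complex.continuous_conj.measurable.comp hv.measurable).div
      (Complex.measurable_ofReal.comp hv.measurable.norm)).stronglyMeasurable
  have h1 : ∫ t, (conj (v t) / (‖v t‖ : ℂ)) * v t ∂dm = 0 := by
    refine integral_mul_eq_zero hm.aestronglyMeasurable (M := 1) (ae_of_all _ fun t => ?_)
      (hu.congr huv) fun n => Or.inr ?_
    · rw [norm_div, RCLike.norm_conj, Complex.norm_real, norm_norm]
      exact div_self_le_one _
    · rw [← fourierCoeff_congr_ae huv]; exact h _
  have h2 : ∀ t, (conj (v t) / (‖v t‖ : ℂ)) * v t = ((‖v t‖ : ℝ) : ℂ) := by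
    intro t
    rcases eq_or_ne (v t) 0 with h0 | h0
    · simp [h0]
    · have : (‖v t‖ : ℂ) ≠ 0 := by simpa using h0
      field_simp
      rw [Complex.conj_mul']
  simp_rw [h2] at h1
  rw [integral_complex_ofReal, Complex.ofReal_eq_zero,
    integral_eq_zero_iff_of_nonneg (fun t => norm_nonneg _) (hu.congr huv).norm] at h1
  filter_upwards [huv, h1] with t h3 h4
  rw [h3]; simpa using h4

/-- `u` is integrable and its Fourier coefficients of index less than `a` vanish. -/
structure FreqGE (a : ℤ) (u : Freq → ℂ) : Prop where
  integrable : Integrable u dm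
  coeff : ∀ n < a, fourierCoeff u n = 0

theorem FreqGE.congr {a : ℤ} {u v : Freq → ℂ} (h : FreqGE a u) (huv : u =ᵐ[dm] v) :
    FreqGE a v :=
  ⟨h.1.congr huv, fun n hn => by rw [← fourierCoeff_congr_ae huv]; exact h.2 n hn⟩

theorem FreqGE.fourier_mul {a : ℤ} {u : Freq → ℂ} (h : FreqGE a u) (m : ℤ) :
    FreqGE (a + m) (fun t => fourier m t * u t) :=
  ⟨integrable_continuous_mul (map_continuous _) h.1, fun n hn => by
    rw [fourierCoeff_fourier_mul]; exact h.2 _ (by omega)⟩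

theorem FreqGE.mul_bdd {a b : ℤ} {φ u : Freq → ℂ} (hφ : FreqGE a φ) (hu : FreqGE b u) {M : ℝ}
    (hM : ∀ᵐ t ∂dm, ‖φ t‖ ≤ M) : FreqGE (a + b) (fun t => φ t * u t) := by
  refine ⟨hu.1.bdd_mul hφ.1.1 hM, fun n hn => ?_⟩
  have h := integral_mul_eq_zero hφ.1.1 hM
    (integrable_continuous_mul (map_continuous (fourier (-n))) hu.1) (fun m => ?_)
  · rw [← h]
    unfold fourierCoeff
    refine integral_congr_ae (ae_of_all _ fun t => ?_)
    simp only [smul_eq_mul]; ring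
  · rw [fourierCoeff_fourier_mul]
    rcases lt_or_ge m a with hm | hm
    · exact Or.inl (hφ.2 m hm)
    · exact Or.inr (hu.2 _ (by omega))

theorem FreqGE.of_tendsto {a : ℤ} {B : ℕ → Freq → ℂ} {u v : Freq → ℂ} (hu : Integrable u dm)
    (hB : ∀ i, FreqGE a (B i)) (hM : ∀ i, ∀ᵐ t ∂dm, ‖B i t‖ ≤ ‖u t‖)
    (hlim : ∀ᵐ t ∂dm, Tendsto (fun i => B i t) atTop (𝓝 (v t))) : FreqGE a v := by
  have hv : AEStronglyMeasurable v dm :=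
    aestronglyMeasurable_of_tendsto_ae atTop (fun i => (hB i).1.1) hlim
  refine ⟨hu.mono hv ?_, fun n hn => ?_⟩
  · filter_upwards [hlim, ae_all_iff.2 hM] with t h1 h2
    exact le_of_tendsto h1.norm (Eventually.of_forall h2)
  · have h : Tendsto (fun i => fourierCoeff (B i) n) atTop (𝓝 (fourierCoeff v n)) := by
      refine tendsto_integral_of_dominated_convergence (fun t => ‖u t‖)
        (fun i => ((hB i).1.fourier_smul _).1) hu.norm (fun i => ?_) ?_
      · filter_upwards [hM i] with t ht
        rwa [norm_smul, norm_fourier_apply, one_mul]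
      · filter_upwards [hlim] with t ht using ht.const_smul _
    exact tendsto_nhds_unique h (tendsto_const_nhds.congr fun i => ((hB i).2 n hn).symm)

theorem FreqGE.sum {ι : Type*} (s : Finset ι) {a : ℤ} {u : ι → Freq → ℂ}
    (h : ∀ i ∈ s, FreqGE a (u i)) : FreqGE a (fun t => ∑ i ∈ s, u i t) := by
  refine ⟨integrable_finsetSum _ fun i hi => (h i hi).1, fun n hn => ?_⟩
  have := congrFun (fourierCoeff.sum s u fun i hi => (h i hi).1) n
  rw [Finset.sum_apply, Finset.sum_eq_zero fun i hi => (h i hi).2 n hn] at this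
  rw [← this]
  congr 1
  ext t
  simp

theorem FreqGE.const_mul {a : ℤ} {u : Freq → ℂ} (h : FreqGE a u) (c : ℂ) :
    FreqGE a (fun t => c * u t) :=
  ⟨h.1.const_mul c, fun n hn => by rw [fourierCoeff.const_mul, h.2 n hn, mul_zero]⟩

theorem FreqGE.sub {a : ℤ} {u v : Freq → ℂ} (hu : FreqGE a u) (hv : FreqGE a v) :
    FreqGE a (fun t => u t - v t) :=
  ⟨hu.1.sub hv.1, fun n hn => by
    rw [fourierCoeff_sub hu.1 hv.1, hu.2 n hn, hv.2 n hn, sub_zero]⟩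

theorem freqGE_const (c : ℂ) : FreqGE 0 (fun _ => c) := by
  refine ⟨integrable_const _, fun n hn => ?_⟩
  have h1 := congrFun (fourierCoeff_fourier (T := 2 * π) 0) n
  have h2 : (fun _ : Freq => c) = fun t => c * fourier 0 t := by ext; simp
  rw [h2, fourierCoeff.const_mul, h1, Pi.single_apply, if_neg hn.ne, mul_zero]

theorem FreqGE.fejer {a : ℤ} {u : Freq → ℂ} (h : FreqGE a u) (N : ℕ) :
    FreqGE a (NoisyFilter.fejer N u) := by
  have h1 : FreqGE a (fun t => (N : ℂ)⁻¹ * ∑ j ∈ Finset.range N, ∑ k ∈ Finset.range N,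
      fourierCoeff u ((j : ℤ) - k) * fourier ((j : ℤ) - k) t) := by
    refine (FreqGE.sum _ fun j _ => FreqGE.sum _ fun k _ => ?_).const_mul _
    refine ⟨((integrable_const (1 : ℂ)).fourier_smul _ |>.const_mul _).congr
      (ae_of_all _ fun t => by simp; rfl), fun n hn => ?_⟩
    rw [fourierCoeff.const_mul]
    rcases lt_or_ge ((j : ℤ) - k) a with h2 | h2
    · rw [h.2 _ h2, zero_mul]
    · rw [congrFun (fourierCoeff_fourier (T := 2 * π) _) n, Pi.single_apply, if_neg (by omega),
        mul_zero]
  refine h1.congr (ae_of_all _ fun t => ?_)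
  simp [NoisyFilter.fejer]

theorem FreqGE.pow {u : Freq → ℂ} (h : FreqGE 0 u) {M : ℝ} (hM : ∀ t, ‖u t‖ ≤ M) (k : ℕ) :
    FreqGE 0 (fun t => u t ^ k) := by
  induction k with
  | zero => simpa using freqGE_const 1
  | succ k ih =>
    simp_rw [pow_succ']
    simpa using h.mul_bdd ih (ae_of_all _ hM)

theorem one_le_norm_one_add {z : ℂ} (hz : 0 ≤ z.re) : 1 ≤ ‖1 + z‖ :=
  le_trans (by simpa using hz) (Complex.re_le_norm (1 + z))

/-- Neumann series about a large R: 1 + q = R(1 - s) with s = (R - 1 - q)/R. As Re q ≥ 0, |R - 1 -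
q|² ≤ (R - 1)² + M², which is below R² once R ≥ M² + 2, so |s| ≤ ρ < 1 uniformly. -/
theorem FreqGE.inv_one_add_of_bdd {q : Freq → ℂ} (h : FreqGE 0 q) {M : ℝ} (hM : ∀ t, ‖q t‖ ≤ M)
    (hre : ∀ t, 0 ≤ (q t).re) : FreqGE 0 (fun t => (1 + q t)⁻¹) := by
  obtain ⟨R, hR1, hR2⟩ : ∃ R : ℝ, 1 < R ∧ M ^ 2 + 2 ≤ R :=
    ⟨M ^ 2 + 2, by nlinarith [sq_nonneg M], le_rfl⟩
  set ρ : ℝ := √((R - 1) ^ 2 + M ^ 2) / R with hρ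
  have hρ0 : 0 ≤ ρ := by positivity
  have hρ1 : ρ < 1 := by
    rw [hρ, div_lt_one (by linarith), Real.sqrt_lt' (by linarith)]
    nlinarith
  set s : Freq → ℂ := fun t => ((R : ℂ) - 1 - q t) * (R : ℂ)⁻¹ with hs
  have hR0 : (R : ℂ) ≠ 0 := by norm_cast; linarith
  have hsb : ∀ t, ‖s t‖ ≤ ρ := by
    intro t
    have : ‖(R : ℂ) - 1 - q t‖ ≤ √((R - 1) ^ 2 + M ^ 2) := by
      refine Real.le_sqrt_of_sq_le ?_
      have h1 := Complex.sq_norm (q t)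
      have h2 : ‖q t‖ ^ 2 ≤ M ^ 2 := pow_le_pow_left₀ (norm_nonneg _) (hM t) 2
      rw [Complex.sq_norm]
      rw [Complex.normSq_apply] at h1 ⊢
      simp only [Complex.sub_re, Complex.ofReal_re, Complex.one_re, Complex.sub_im,
        Complex.ofReal_im, Complex.one_im]
      nlinarith [hre t, mul_nonneg (hre t) (by linarith : 0 ≤ R - 1)]
    rw [hs]
    simp only [norm_mul, norm_inv, Complex.norm_real]
    rw [Real.norm_of_nonneg (by linarith), ← div_eq_mul_inv]
    exact div_le_div_of_nonneg_right this (by linarith)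
  have hsF : FreqGE 0 s := by
    have := ((freqGE_const ((R : ℂ) - 1)).sub h).const_mul (R : ℂ)⁻¹
    simpa [hs, mul_comm] using this
  have hinv : ∀ t, (1 + q t)⁻¹ = (R : ℂ)⁻¹ * (1 - s t)⁻¹ := by
    intro t
    rw [← mul_inv, hs]
    congr 1
    field_simp
    ring
  have hsum : ∀ K, FreqGE 0 (fun t => (R : ℂ)⁻¹ * ∑ k ∈ Finset.range K, s t ^ k) := fun K =>
    (FreqGE.sum _ fun k _ => hsF.pow hsb k).const_mul _
  refine FreqGE.of_tendsto (integrable_const (((R⁻¹ * (1 - ρ)⁻¹ : ℝ)) : ℂ)) hsum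
    (fun K => ae_of_all _ fun t => ?_) (ae_of_all _ fun t => ?_)
  · have hpos : 0 ≤ (1 - ρ)⁻¹ := inv_nonneg.2 (by linarith)
    rw [norm_mul, norm_inv, Complex.norm_real, Complex.norm_real,
      Real.norm_of_nonneg (by linarith : 0 ≤ R), Real.norm_of_nonneg (by positivity)]
    refine mul_le_mul_of_nonneg_left ?_ (by positivity)
    refine (norm_sum_le _ _).trans ?_
    rw [← tsum_geometric_of_lt_one hρ0 hρ1]
    refine (Finset.sum_le_sum fun k _ => ?_).trans
      ((summable_geometric_of_lt_one hρ0 hρ1).sum_le_tsum _ fun k _ => by positivity)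
    rw [norm_pow]
    exact pow_le_pow_left₀ (norm_nonneg _) (hsb t) k
  · rw [hinv]
    exact ((hasSum_geometric_of_norm_lt_one ((hsb t).trans_lt hρ1)).tendsto_sum_nat).const_mul _

/-- The Fejér means of A are bounded and stay in the closed right half-plane, so the bounded case
applies to them. The inverses are at most 1 in modulus, which allows passage to the limit. -/
theorem FreqGE.inv_one_add {A : Freq → ℂ} (h : FreqGE 0 A) (h2 : MemLp A 2 dm)
    (hre : ∀ᵐ t ∂dm, 0 ≤ (A t).re) : FreqGE 0 (fun t => (1 + A t)⁻¹) := by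
  obtain ⟨ns, hns, hlim⟩ := exists_seq_tendsto_fejer h2
  have hp : ∀ i t, 0 ≤ (NoisyFilter.fejer (ns i) A t).re := fun i t => re_fejer_nonneg _ h.1 hre t
  refine FreqGE.of_tendsto (integrable_const (1 : ℂ))
    (fun i => (h.fejer (ns i)).inv_one_add_of_bdd (M := ‖NoisyFilter.fejer (ns i) A‖)
      (fun t => ContinuousMap.norm_coe_le_norm _ t) (hp i))
    (fun i => ae_of_all _ fun t => ?_) ?_
  · rw [norm_inv, norm_one]
    exact inv_le_one_of_one_le₀ (one_le_norm_one_add (hp i t))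
  · filter_upwards [hlim, hre] with t ht hre
    refine (ht.const_add 1).inv₀ fun h0 => ?_
    have := one_le_norm_one_add hre
    rw [h0, norm_zero] at this
    linarith

/-! ### Fourier coefficients of square-summable series -/

theorem integrable_of_memLp_two {u : Freq → ℂ} (hu : MemLp u 2 dm) : Integrable u dm :=
  hu.integrable (by norm_num)

theorem memLp_conj {u : Freq → ℂ} (hu : MemLp u 2 dm) : MemLp (fun t => conj (u t)) 2 dm :=
  hu.of_le (Complex.continuous_conj.comp_aestronglyMeasurable hu.1)
    (ae_of_all _ fun t => by simp)

theorem memLp_fourier_mul {u : Freq → ℂ} (hu : MemLp u 2 dm) (m : ℤ) :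
    MemLp (fun t => fourier m t * u t) 2 dm :=
  hu.of_le ((map_continuous _).aestronglyMeasurable.mul hu.1)
    (ae_of_all _ fun t => by rw [norm_mul, norm_fourier_apply, one_mul])

theorem integrable_conj {u : Freq → ℂ} (hu : Integrable u dm) :
    Integrable (fun t => conj (u t)) dm :=
  hu.mono (Complex.continuous_conj.comp_aestronglyMeasurable hu.1) (ae_of_all _ fun t => by simp)

/-- For v in L₂, the m-th coefficient of a product with v is a continuous functional on L₂, so the
series may be taken termwise. Matrix entries and Fourier integrals are exchanged through this. -/
theorem hasSum_fourierCoeff_expSeries_mul {n : ℕ → ℤ} (hn : Function.Injective n) (c : Ell2)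
    {v : Freq → ℂ} (hv : MemLp v 2 dm) (m : ℤ) :
    HasSum (fun k => c k * fourierCoeff v (m - n k))
      (fourierCoeff (fun t => expSeries n hn c t * v t) m) := by
  have hw := memLp_conj (memLp_fourier_mul hv (-m))
  have key : ∀ u : Lp ℂ 2 dm, inner ℂ (hw.toLp _) u =
      fourierCoeff (fun t => u t * v t) m := by
    intro u
    rw [L2.inner_def]
    refine integral_congr_ae ?_
    filter_upwards [hw.coeFn_toLp] with t ht
    rw [ht]
    simp only [RCLike.inner_apply, Complex.conj_conj, smul_eq_mul]
    ring
  have hs := (hasSum_expSeries n hn c).mapL (innerSL ℂ (hw.toLp _))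
  have h2 : ∀ k, innerSL ℂ (hw.toLp _) (c k • (fourierLp 2 (n k) : Lp ℂ 2 dm)) =
      c k * fourierCoeff v (m - n k) := by
    intro k
    rw [map_smul, innerSL_apply_apply, key, smul_eq_mul, ← fourierCoeff_fourier_mul]
    congr 1
    refine congrFun (fourierCoeff_congr_ae ?_) m
    filter_upwards [coeFn_fourierLp (T := 2 * π) 2 (n k)] with t ht
    rw [ht]
  simp only [h2] at hs
  rwa [innerSL_apply_apply, key] at hs

theorem hasSum_fourierCoeff_expSeries {n : ℕ → ℤ} (hn : Function.Injective n) (c : Ell2) (m : ℤ) :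
    HasSum (fun k => if m = n k then c k else 0) (fourierCoeff (expSeries n hn c) m) := by
  have h := hasSum_fourierCoeff_expSeries_mul hn c (memLp_const (1 : ℂ)) m
  simpa [fourierCoeff_one, sub_eq_zero] using h

theorem fourierCoeff_expSeries {n : ℕ → ℤ} (hn : Function.Injective n) (c : Ell2) (k : ℕ) :
    fourierCoeff (expSeries n hn c) (n k) = c k := by
  refine (hasSum_fourierCoeff_expSeries hn c (n k)).unique ?_
  convert hasSum_ite_eq k (c k) using 2 with j
  by_cases h : j = k
  · simp [h]
  · rw [if_neg h, if_neg fun h' => h (hn h'.symm)]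

theorem fourierCoeff_expSeries_of_notMem {n : ℕ → ℤ} (hn : Function.Injective n) (c : Ell2) {m : ℤ}
    (hm : ∀ k, m ≠ n k) : fourierCoeff (expSeries n hn c) m = 0 := by
  refine (hasSum_fourierCoeff_expSeries hn c m).unique ?_
  simp only [if_neg (hm _)]
  exact hasSum_zero

theorem memLp_expSeries {n : ℕ → ℤ} (hn : Function.Injective n) (c : Ell2) :
    MemLp (expSeries n hn c) 2 dm := Lp.memLp _

theorem memℓp_fourierCoeff {u : Freq → ℂ} (hu : MemLp u 2 dm) {n : ℕ → ℤ}
    (hn : Function.Injective n) : Memℓp (fun k => fourierCoeff u (n k)) 2 := by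
  have h1 : Summable fun i : ℤ => ‖fourierBasis.repr (hu.toLp _) i‖ ^ (2 : ℝ) := by
    simpa using (lp.memℓp (fourierBasis.repr (hu.toLp _))).summable (by norm_num)
  refine memℓp_gen ?_
  simp only [ENNReal.toReal_ofNat]
  refine (h1.comp_injective hn).congr fun l => ?_
  simp only [Function.comp_apply]
  rw [fourierBasis_repr, fourierCoeff_congr_ae hu.coeFn_toLp]

theorem ae_eq_of_fourierCoeff {u v : Freq → ℂ} (hu : Integrable u dm) (hv : Integrable v dm)
    (h : ∀ n, fourierCoeff u n = fourierCoeff v n) : u =ᵐ[dm] v := by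
  have := ae_eq_zero_of_fourierCoeff (hu.sub hv) fun n => by
    rw [← sub_eq_zero.2 (h n), ← fourierCoeff_sub hu hv]; rfl
  filter_upwards [this] with t ht
  simpa [sub_eq_zero] using ht

theorem integrable_expSeries {n : ℕ → ℤ} (hn : Function.Injective n) (c : Ell2) :
    Integrable (expSeries n hn c) dm := integrable_of_memLp_two (memLp_expSeries hn c)

theorem fourierCoeff_futureSeries (c : Ell2) (k : ℕ) :
    fourierCoeff (futureSeries c) ((k : ℤ) + 1) = c k :=
  fourierCoeff_expSeries inj_succ c k

theorem freqGE_futureSeries (c : Ell2) : FreqGE 1 (futureSeries c) :=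
  ⟨integrable_expSeries _ c, fun n hn =>
    fourierCoeff_expSeries_of_notMem inj_succ c fun k => by omega⟩

theorem fourierCoeff_pastSeries (c : Ell2) (k : ℕ) :
    fourierCoeff (pastSeries c) (-(k : ℤ)) = c k :=
  fourierCoeff_expSeries inj_neg c k

theorem fourierCoeff_pastSeries_of_pos (c : Ell2) {n : ℤ} (hn : 0 < n) :
    fourierCoeff (pastSeries c) n = 0 :=
  fourierCoeff_expSeries_of_notMem inj_neg c fun k => by omega

theorem freqGE_conj {a : ℤ} {u : Freq → ℂ} (hu : Integrable u dm)
    (h : ∀ n, -a < n → fourierCoeff u n = 0) : FreqGE a (fun t => conj (u t)) :=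
  ⟨integrable_conj hu, fun n hn => by rw [fourierCoeff_conj, h _ (by omega), map_zero]⟩

theorem freqGE_conj_pastSeries (c : Ell2) : FreqGE 0 (fun t => conj (pastSeries c t)) :=
  freqGE_conj (integrable_expSeries _ c) fun _ hn => fourierCoeff_pastSeries_of_pos c (by omega)

theorem FreqGE.eq_futureSeries {u : Freq → ℂ} (hu : FreqGE 1 u) {c : Ell2}
    (hc : ∀ k : ℕ, fourierCoeff u ((k : ℤ) + 1) = c k) : u =ᵐ[dm] futureSeries c := by
  refine ae_eq_of_fourierCoeff hu.1 (freqGE_futureSeries c).1 fun n => ?_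
  rcases lt_or_ge n 1 with hn | hn
  · rw [hu.2 n hn, (freqGE_futureSeries c).2 n hn]
  · obtain ⟨k, rfl⟩ : ∃ k : ℕ, n = (k : ℤ) + 1 := ⟨(n - 1).toNat, by omega⟩
    rw [hc, fourierCoeff_futureSeries]

/-! ### Bounded analytic multipliers -/

/-- Every real `a ∈ L₂` is the real part of a function with spectrum in `[0, ∞)`. -/
theorem exists_freqGE_re_eq {a : Freq → ℝ} (ha : MemLp (fun t => (a t : ℂ)) 2 dm) :
    ∃ A : Freq → ℂ, FreqGE 0 A ∧ MemLp A 2 dm ∧ ∀ᵐ t ∂dm, (A t).re = a t := by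
  have hinj : Function.Injective fun k : ℕ => (k : ℤ) := Nat.cast_injective
  set α : ℤ → ℂ := fourierCoeff (fun t => (a t : ℂ)) with hα
  have hconj : ∀ n, conj (α (-n)) = α n := by
    intro n
    rw [hα, ← fourierCoeff_conj]
    simp
  let c : Ell2 := ⟨fun k => α k, memℓp_fourierCoeff ha hinj⟩
  let S := expSeries _ hinj c
  have hS : Integrable S dm := integrable_expSeries _ _
  have hS0 : ∀ n < 0, fourierCoeff S n = 0 := fun n hn =>
    fourierCoeff_expSeries_of_notMem hinj c fun k => by omega
  have hS1 : ∀ n, 0 ≤ n → fourierCoeff S n = α n := fun n hn => by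
    obtain ⟨k, rfl⟩ := Int.eq_ofNat_of_zero_le hn
    exact fourierCoeff_expSeries hinj c k
  -- Twice the nonnegative-frequency half of a, corrected at frequency zero, which would be counted
  -- twice in A + conj A = 2a.
  have hA : FreqGE 0 (fun t => 2 * S t - α 0) :=
    (FreqGE.const_mul ⟨hS, hS0⟩ 2).sub (freqGE_const _)
  refine ⟨fun t => 2 * S t - α 0, hA, ((memLp_expSeries _ _).const_mul 2).sub (memLp_const _), ?_⟩
  have hAc : ∀ n, fourierCoeff (fun t => 2 * S t - α 0) n =
      2 * fourierCoeff S n - if n = 0 then α 0 else 0 := by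
    intro n
    rw [fourierCoeff_sub (hS.const_mul 2) (integrable_const _), fourierCoeff.const_mul]
    have := fourierCoeff.const_mul (fun _ : Freq => (1 : ℂ)) (α 0) n
    simp only [mul_one] at this
    rw [this, fourierCoeff_one]
    simp
  have hae := ae_eq_of_fourierCoeff
    (u := fun t => 2 * (a t : ℂ) - (2 * S t - α 0)) (v := fun t => conj (2 * S t - α 0))
    (((integrable_of_memLp_two ha).const_mul 2).sub hA.1) (integrable_conj hA.1) fun n => by
      rw [fourierCoeff_sub ((integrable_of_memLp_two ha).const_mul 2) hA.1, fourierCoeff_conj,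
        hAc, hAc, fourierCoeff.const_mul]
      change 2 * α n - _ = _
      rcases lt_trichotomy n 0 with hn | rfl | hn
      · rw [hS0 n hn, hS1 (-n) (by omega), if_neg hn.ne, if_neg (by omega)]
        simp [hconj, Complex.conj_ofNat]
      · have h0 := hconj 0
        rw [neg_zero] at h0
        rw [neg_zero, hS1 0 le_rfl]
        simp only [if_true, map_sub, map_mul, h0, Complex.conj_ofNat]
        ring
      · rw [hS0 (-n) (by omega), hS1 n (by omega), if_neg hn.ne', if_neg (by omega)]
        simp
  filter_upwards [hae] with t ht
  have := congrArg Complex.re ht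
  simp only [Complex.sub_re, Complex.mul_re, Complex.conj_re, Complex.ofReal_re,
    Complex.re_ofNat, Complex.im_ofNat, Complex.ofReal_im] at this ⊢
  linarith

/-- Take b_i = 1/(1 + A/(i+1)) with Re A = a. The denominator has real part 1 + a/(i+1), which gives
all the bounds. Multiplying by b_i truncates at the scale of a without leaving the functions with
spectrum in [0, ∞). -/
theorem exists_seq_multiplier {a : Freq → ℝ} (ha : MemLp (fun t => (a t : ℂ)) 2 dm)
    (h0 : ∀ t, 0 ≤ a t) :
    ∃ b : ℕ → Freq → ℂ, (∀ i, FreqGE 0 (b i)) ∧ (∀ᵐ t ∂dm, ∀ i, ‖b i t‖ ≤ 1) ∧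
      (∀ᵐ t ∂dm, ∀ i, 0 ≤ (b i t).re) ∧ (∀ᵐ t ∂dm, ∀ i, ‖b i t‖ * a t ≤ i + 1) ∧
      ∀ᵐ t ∂dm, Tendsto (fun i => b i t) atTop (𝓝 1) := by
  obtain ⟨A, hA, hA2, hre⟩ := exists_freqGE_re_eq ha
  have hsc : ∀ (i : ℕ) (z : ℂ), ((((i : ℂ) + 1)⁻¹) * z).re = ((i : ℝ) + 1)⁻¹ * z.re := by
    intro i z
    have : ((i : ℂ) + 1)⁻¹ = (((i : ℝ) + 1)⁻¹ : ℝ) := by push_cast; rfl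
    rw [this, Complex.re_ofReal_mul]
  have hpos : ∀ i : ℕ, (0 : ℝ) < (i : ℝ) + 1 := fun i => by positivity
  refine ⟨fun i t => (1 + ((i : ℂ) + 1)⁻¹ * A t)⁻¹, fun i => ?_, ?_, ?_, ?_, ?_⟩
  · refine (hA.const_mul _).inv_one_add (hA2.const_mul _) ?_
    filter_upwards [hre] with t ht
    rw [hsc, ht]
    exact mul_nonneg (inv_nonneg.2 (hpos i).le) (h0 t)
  · filter_upwards [hre] with t ht i
    rw [norm_inv]
    refine inv_le_one_of_one_le₀ (one_le_norm_one_add ?_)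
    rw [hsc, ht]
    exact mul_nonneg (inv_nonneg.2 (hpos i).le) (h0 t)
  · filter_upwards [hre] with t ht i
    rw [Complex.inv_re]
    refine div_nonneg ?_ (Complex.normSq_nonneg _)
    rw [Complex.add_re, hsc, ht, Complex.one_re]
    exact add_nonneg zero_le_one (mul_nonneg (inv_nonneg.2 (hpos i).le) (h0 t))
  · filter_upwards [hre] with t ht i
    have h1 : ((i : ℝ) + 1)⁻¹ * a t ≤ ‖1 + ((i : ℂ) + 1)⁻¹ * A t‖ := by
      refine le_trans ?_ (Complex.re_le_norm _)
      rw [Complex.add_re, hsc, ht, Complex.one_re]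
      linarith
    have h2 : 1 ≤ ‖1 + ((i : ℂ) + 1)⁻¹ * A t‖ := by
      refine one_le_norm_one_add ?_
      rw [hsc, ht]
      exact mul_nonneg (inv_nonneg.2 (hpos i).le) (h0 t)
    rw [norm_inv, inv_mul_le_iff₀ (by linarith)]
    rwa [inv_mul_le_iff₀ (hpos i), mul_comm] at h1
  · refine ae_of_all _ fun t => ?_
    have h1 : Tendsto (fun i : ℕ => ((i : ℂ) + 1)⁻¹) atTop (𝓝 0) := by
      simpa using tendsto_one_div_add_atTop_nhds_zero_nat (𝕜 := ℂ)
    simpa using ((h1.mul_const (A t)).const_add 1).inv₀ (by simp)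

/-- A product of integrable functions with spectra in `[1, ∞)` and `[0, ∞)` has mean zero as soon as
it is integrable. -/
theorem integral_mul_eq_zero_of_freqGE {u v : Freq → ℂ} (hu : FreqGE 1 u) (hv : FreqGE 0 v)
    (huv : Integrable (fun t => u t * v t) dm) : ∫ t, u t * v t ∂dm = 0 := by
  -- The multipliers need a majorant in L₂, and |u| is only integrable. So they are built for √|u|
  -- and applied twice: |b_i² u| ≤ (i+1)².
  have ha : MemLp (fun t => ((√‖u t‖ : ℝ) : ℂ)) 2 dm := by
    have hm : AEStronglyMeasurable (fun t => ((√‖u t‖ : ℝ) : ℂ)) dm :=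
      (Complex.continuous_ofReal.comp Real.continuous_sqrt).comp_aestronglyMeasurable hu.1.1.norm
    refine (memLp_two_iff_integrable_sq_norm hm).2 (hu.1.norm.congr (ae_of_all _ fun t => ?_))
    simp only [Complex.norm_real]
    rw [Real.norm_of_nonneg (Real.sqrt_nonneg _), Real.sq_sqrt (norm_nonneg _)]
  obtain ⟨b, hb, hb1, -, hba, hlim⟩ := exists_seq_multiplier ha fun t => Real.sqrt_nonneg _
  have h1 : ∀ i, ∀ᵐ t ∂dm, ‖b i t‖ ≤ 1 := fun i => hb1.mono fun t ht => ht i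
  have h2 : ∀ i, FreqGE 1 (fun t => b i t * (b i t * u t)) := fun i => by
    simpa using (hb i).mul_bdd ((hb i).mul_bdd hu (h1 i)) (h1 i)
  have h3 : ∀ i : ℕ, ∀ᵐ t ∂dm, ‖b i t * (b i t * u t)‖ ≤ ((i : ℝ) + 1) ^ 2 := fun i => by
    filter_upwards [hba] with t ht
    have h4 : ‖b i t * (b i t * u t)‖ = (‖b i t‖ * √‖u t‖) ^ 2 := by
      rw [mul_pow, Real.sq_sqrt (norm_nonneg _), norm_mul, norm_mul]; ring
    rw [h4]
    exact pow_le_pow_left₀ (by positivity) (ht i) 2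
  have h4 : ∀ i, ∫ t, b i t * (b i t * u t) * v t ∂dm = 0 := fun i => by
    have := ((h2 i).mul_bdd hv (h3 i)).2 0 (by norm_num)
    simpa [fourierCoeff] using this
  have h5 : Tendsto (fun i => ∫ t, b i t * (b i t * u t) * v t ∂dm) atTop
      (𝓝 (∫ t, u t * v t ∂dm)) := by
    refine tendsto_integral_of_dominated_convergence (fun t => ‖u t * v t‖)
      (fun i => (h2 i).1.1.mul hv.1.1) huv.norm (fun i => ?_) ?_
    · filter_upwards [h1 i] with t ht
      have : ‖b i t * (b i t * u t) * v t‖ = ‖b i t‖ * ‖b i t‖ * ‖u t * v t‖ := by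
        simp only [norm_mul]; ring
      rw [this]
      exact mul_le_of_le_one_left (norm_nonneg _) (mul_le_one₀ ht (norm_nonneg _) ht)
    · filter_upwards [hlim] with t ht
      simpa using (ht.mul (ht.mul_const (u t))).mul_const (v t)
  exact tendsto_nhds_unique h5 (tendsto_const_nhds.congr fun i => (h4 i).symm)

theorem freqGE_mul {a b : ℤ} {u v : Freq → ℂ} (hu : FreqGE a u) (hv : FreqGE b v)
    (huv : Integrable (fun t => u t * v t) dm) : FreqGE (a + b) (fun t => u t * v t) := by
  refine ⟨huv, fun n hn => ?_⟩
  have h1 : FreqGE 1 (fun t => fourier (b - n) t * u t) := by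
    have := hu.fourier_mul (b - n)
    exact ⟨this.1, fun m hm => this.2 m (by omega)⟩
  have h2 : FreqGE 0 (fun t => fourier (-b) t * v t) := by simpa using hv.fourier_mul (-b)
  have h3 : ∀ t, fourier (b - n) t * u t * (fourier (-b) t * v t) =
      fourier (-n) t • (u t * v t) := fun t => by
    have : fourier (-n) t = fourier (b - n) t * fourier (-b) t := by
      rw [← fourier_add]; congr 2; ring
    rw [this, smul_eq_mul]; ring
  have := integral_mul_eq_zero_of_freqGE h1 h2 (by simpa only [h3] using huv.fourier_smul (-n))
  simp only [h3] at this
  exact this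

/-! ### The quadratic form of the operator -/

/-- The function conj(G - Cw) has spectrum in [0, ∞) and C in [1, ∞), so formally their product has
mean zero, which is the identity. Integrability of |C|² w is not known beforehand: it is obtained
from the same identity with b_i C, which is bounded, in place of C. -/
theorem integrable_sq_mul_of_fourierCoeff_eq {C G : Freq → ℂ} {w : Freq → ℝ} (hC : FreqGE 1 C)
    (hC2 : MemLp C 2 dm) (hG : MemLp G 2 dm) (hw : ∀ᵐ t ∂dm, 0 ≤ w t)
    (hCw : Integrable (fun t => C t * (w t : ℂ)) dm)
    (h : ∀ n, 0 < n → fourierCoeff (fun t => C t * (w t : ℂ)) n = fourierCoeff G n) :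
    Integrable (fun t => ‖C t‖ ^ 2 * w t) dm ∧
      ∫ t, C t * conj (G t) ∂dm = ((∫ t, ‖C t‖ ^ 2 * w t ∂dm : ℝ) : ℂ) := by
  have hGi := integrable_of_memLp_two hG
  have hh : FreqGE 0 (fun t => conj (G t - C t * (w t : ℂ))) :=
    freqGE_conj (hGi.sub hCw) fun n hn => by
      rw [fourierCoeff_sub hGi hCw, h n (by omega), sub_self]
  have hCG : Integrable (fun t => C t * conj (G t)) dm := hC2.integrable_mul (memLp_conj hG)
  have hsq : ∀ t, ((‖C t‖ ^ 2 * w t : ℝ) : ℂ) = C t * conj (C t * (w t : ℂ)) := fun t => by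
    rw [map_mul, Complex.conj_ofReal, ← mul_assoc, Complex.mul_conj']; push_cast; ring
  have hmeas : AEStronglyMeasurable (fun t => ‖C t‖ ^ 2 * w t) dm := by
    have h1 : AEStronglyMeasurable (fun t => (C t * conj (C t * (w t : ℂ))).re) dm :=
      Complex.continuous_re.comp_aestronglyMeasurable
        (hC2.1.mul (Complex.continuous_conj.comp_aestronglyMeasurable hCw.1))
    refine h1.congr (ae_of_all _ fun t => ?_)
    simp only [← hsq, Complex.ofReal_re]
  have hint : Integrable (fun t => ‖C t‖ ^ 2 * w t) dm := by
    have ha : MemLp (fun t => ((‖C t‖ : ℝ) : ℂ)) 2 dm :=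
      hC2.norm.ofReal
    obtain ⟨b, hb, hb1, hbre, hba, hlim⟩ := exists_seq_multiplier ha fun t => norm_nonneg _
    have h1 : ∀ i, ∀ᵐ t ∂dm, ‖b i t‖ ≤ 1 := fun i => hb1.mono fun t ht => ht i
    have h2 : ∀ i, FreqGE 1 (fun t => b i t * C t) := fun i => by
      simpa using (hb i).mul_bdd hC (h1 i)
    have h3 : ∀ i : ℕ, ∀ᵐ t ∂dm, ‖b i t * C t‖ ≤ (i : ℝ) + 1 := fun i => by
      filter_upwards [hba] with t ht
      rw [norm_mul]; exact ht i
    have h4 : ∀ i, ∫ t, b i t * C t * conj (G t - C t * (w t : ℂ)) ∂dm = 0 := fun i => by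
      have := ((h2 i).mul_bdd hh (h3 i)).2 0 (by norm_num)
      simpa [fourierCoeff] using this
    have h5 : ∀ i, Integrable (fun t => b i t * (‖C t‖ ^ 2 * w t : ℝ)) dm := fun i => by
      refine ((integrable_conj hCw).bdd_mul (h2 i).1.1 (h3 i)).congr (ae_of_all _ fun t => ?_)
      simp only [hsq]; ring
    have h6 : ∀ i, Integrable (fun t => b i t * (C t * conj (G t))) dm := fun i =>
      hCG.bdd_mul (hb i).1.1 (h1 i)
    -- Since |b_i| ≤ 1, the regularized quadratic forms are bounded independently of i.
    have h7 : ∀ i, ∫ t, (b i t).re * (‖C t‖ ^ 2 * w t) ∂dm ≤ ∫ t, ‖C t * conj (G t)‖ ∂dm := by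
      intro i
      have h8 : ∫ t, b i t * (‖C t‖ ^ 2 * w t : ℝ) ∂dm = ∫ t, b i t * (C t * conj (G t)) ∂dm := by
        rw [eq_comm, ← sub_eq_zero, ← integral_sub (h6 i) (h5 i), ← h4 i]
        refine integral_congr_ae (ae_of_all _ fun t => ?_)
        simp only [hsq, map_sub]; ring
      calc ∫ t, (b i t).re * (‖C t‖ ^ 2 * w t) ∂dm
          = (∫ t, b i t * (‖C t‖ ^ 2 * w t : ℝ) ∂dm).re := by
            have := integral_re (𝕜 := ℂ) (h5 i)
            simp only [RCLike.re_eq_complex_re] at this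
            rw [← this]
            exact integral_congr_ae (ae_of_all _ fun t => by simp only [Complex.re_mul_ofReal])
        _ ≤ ‖∫ t, b i t * (C t * conj (G t)) ∂dm‖ := by rw [h8]; exact Complex.re_le_norm _
        _ ≤ ∫ t, ‖C t * conj (G t)‖ ∂dm := by
            refine norm_integral_le_of_norm_le hCG.norm ?_
            filter_upwards [h1 i] with t ht
            rw [norm_mul]
            exact mul_le_of_le_one_left (norm_nonneg _) ht
    refine ⟨hmeas, ?_⟩
    rw [hasFiniteIntegral_iff_ofReal (hw.mono fun t ht => by positivity)]
    have h9 : ∀ i, AEMeasurable (fun t => ENNReal.ofReal ((b i t).re * (‖C t‖ ^ 2 * w t))) dm :=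
      fun i => ((Complex.measurable_re.comp_aemeasurable (hb i).1.1.aemeasurable).mul
        hmeas.aemeasurable).ennreal_ofReal
    -- Re b_i is nonnegative and tends to 1, so Fatou's lemma turns the uniform bound into
    -- finiteness of ∫ |C|² w.
    have h13 : liminf (fun i => ∫⁻ t, ENNReal.ofReal ((b i t).re * (‖C t‖ ^ 2 * w t)) ∂dm) atTop ≤
        ENNReal.ofReal (∫ t, ‖C t * conj (G t)‖ ∂dm) := by
      refine liminf_le_of_le (by isBoundedDefault) fun c hc => ?_
      obtain ⟨i, hi⟩ := hc.exists
      refine hi.trans ?_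
      rw [← ofReal_integral_eq_lintegral_ofReal]
      · exact ENNReal.ofReal_le_ofReal (h7 i)
      · refine (h5 i).re.congr (ae_of_all _ fun t => ?_)
        simp only [RCLike.re_eq_complex_re, Complex.re_mul_ofReal]
      · filter_upwards [hbre, hw] with t h11 h12
        exact mul_nonneg (h11 i) (by positivity)
    refine lt_of_le_of_lt (le_trans (lintegral_mono_ae ?_) (lintegral_liminf_le' h9))
      (h13.trans_lt ENNReal.ofReal_lt_top)
    filter_upwards [hlim] with t ht
    have h10 : Tendsto (fun i => (b i t).re * (‖C t‖ ^ 2 * w t)) atTop (𝓝 (‖C t‖ ^ 2 * w t)) := by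
      simpa using ((Complex.continuous_re.tendsto 1).comp ht).mul_const (‖C t‖ ^ 2 * w t)
    exact (ENNReal.tendsto_ofReal h10).liminf_eq.ge
  refine ⟨hint, ?_⟩
  have hint' : Integrable (fun t => ((‖C t‖ ^ 2 * w t : ℝ) : ℂ)) dm := hint.ofReal
  have hz := integral_mul_eq_zero_of_freqGE hC hh ((hCG.sub hint').congr (ae_of_all _ fun t => by
    simp only [Pi.sub_apply, hsq, map_sub]; ring))
  rw [← integral_complex_ofReal, ← sub_eq_zero, ← integral_sub hCG hint', ← hz]
  refine integral_congr_ae (ae_of_all _ fun t => ?_)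
  simp only [hsq, map_sub]; ring

/-! ### Consequences of minimality -/

section Weight

variable {f g : Freq → ℝ}

theorem aemeasurable_add (hf : IsSpectralDensity f) (hg : IsSpectralDensity g) :
    AEMeasurable (fun t => f t + g t) dm :=
  hf.integrable.aemeasurable.add hg.integrable.aemeasurable

theorem ae_add_pos (hf : IsSpectralDensity f) (hg : IsSpectralDensity g) (hmin : Minimality f g) :
    ∀ᵐ t ∂dm, 0 < f t + g t := by
  filter_upwards [ae_lt_top' (aemeasurable_add hf hg).ennreal_ofReal.inv hmin.ne] with t ht
  rw [Pi.inv_apply, ENNReal.inv_lt_top, ENNReal.ofReal_pos] at ht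
  exact ht

theorem integrable_one_div_add (hf : IsSpectralDensity f) (hg : IsSpectralDensity g)
    (hmin : Minimality f g) : Integrable (fun t => 1 / (f t + g t)) dm := by
  refine ⟨((aemeasurable_add hf hg).const_div 1).aestronglyMeasurable, ?_⟩
  rw [hasFiniteIntegral_iff_ofReal ((ae_add_pos hf hg hmin).mono fun t ht => by positivity)]
  refine lt_of_le_of_lt (lintegral_mono_ae ?_) hmin
  filter_upwards [ae_add_pos hf hg hmin] with t ht
  rw [one_div, ENNReal.ofReal_inv_of_pos ht]

/-! ### The operator `P` and its inverse -/

theorem linearPMap_inverse_eq_iff {R E F : Type*} [Ring R] [AddCommGroup E] [Module R E]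
    [AddCommGroup F] [Module R F] {T : E →ₗ.[R] F} (hT : LinearMap.ker T.toFun = ⊥) (x : F)
    (y : E) : (∃ hx : x ∈ T.inverse.domain, T.inverse ⟨x, hx⟩ = y) ↔
      ∃ hy : y ∈ T.domain, T ⟨y, hy⟩ = x := by
  constructor
  · rintro ⟨hx, rfl⟩
    have hx' := hx
    rw [LinearPMap.inverse_domain] at hx'
    obtain ⟨z, hz⟩ := hx'
    have h := LinearPMap.inverse_apply_eq hT (y := ⟨x, hx⟩) (x := z) hz
    rw [h]
    exact ⟨z.2, hz⟩
  · rintro ⟨hy, h⟩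
    have hx : x ∈ T.inverse.domain := by
      rw [LinearPMap.inverse_domain]
      exact ⟨⟨y, hy⟩, h⟩
    exact ⟨hx, LinearPMap.inverse_apply_eq hT (y := ⟨x, hx⟩) (x := ⟨y, hy⟩) h⟩

/-- The ℓ₂ condition in the domain of P is automatic once the image is a given x in ℓ₂. Only
integrability and the positive coefficients remain. -/
theorem opP_eq_iff (x y : Ell2) : (∃ hy : y ∈ (opP f g).domain, opP f g ⟨y, hy⟩ = x) ↔
    Integrable (fun t => futureSeries y t * ((1 / (f t + g t) : ℝ) : ℂ)) dm ∧
      ∀ l : ℕ, fourierCoeff (fun t => futureSeries y t * ((1 / (f t + g t) : ℝ) : ℂ))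
        ((l : ℤ) + 1) = x l := by
  constructor
  · rintro ⟨hy, rfl⟩
    exact ⟨hy.1, fun l => rfl⟩
  · rintro ⟨h1, h2⟩
    have h3 : actP f g y = x := funext h2
    exact ⟨⟨h1, by rw [h3]; exact lp.memℓp x⟩, lp.ext h3⟩

theorem integrable_sq_div (hf : IsSpectralDensity f) (hg : IsSpectralDensity g)
    {c : Ell2} {G : Freq → ℂ} (hG : MemLp G 2 dm)
    (hc : Integrable (fun t => futureSeries c t * ((1 / (f t + g t) : ℝ) : ℂ)) dm)
    (h : ∀ l : ℕ, fourierCoeff (fun t => futureSeries c t * ((1 / (f t + g t) : ℝ) : ℂ))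
        ((l : ℤ) + 1) = fourierCoeff G ((l : ℤ) + 1)) :
    Integrable (fun t => ‖futureSeries c t‖ ^ 2 * (1 / (f t + g t))) dm ∧
      ∫ t, futureSeries c t * conj (G t) ∂dm =
        ((∫ t, ‖futureSeries c t‖ ^ 2 * (1 / (f t + g t)) ∂dm : ℝ) : ℂ) := by
  refine integrable_sq_mul_of_fourierCoeff_eq (freqGE_futureSeries c) (Lp.memLp _) hG ?_ hc
    fun n hn => ?_
  · filter_upwards [hf.nonneg, hg.nonneg] with t h1 h2
    exact div_nonneg zero_le_one (add_nonneg h1 h2)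
  · obtain ⟨k, rfl⟩ : ∃ k : ℕ, n = (k : ℤ) + 1 := ⟨(n - 1).toNat, by omega⟩
    exact h k

/-- With G = 0 the a priori identity reads ∫ |C|²/(f+g) = 0, and the weight is positive almost
everywhere. -/
theorem ker_opP (hf : IsSpectralDensity f) (hg : IsSpectralDensity g) (hmin : Minimality f g) :
    LinearMap.ker (opP f g).toFun = ⊥ := by
  rw [LinearMap.ker_eq_bot']
  rintro ⟨c, hc⟩ h0
  obtain ⟨h1, h2⟩ := (opP_eq_iff (f := f) (g := g) 0 c).1 ⟨hc, h0⟩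
  obtain ⟨h3, h4⟩ := integrable_sq_div hf hg (memLp_const (0 : ℂ)) h1 fun l => by
    rw [h2]; simp [fourierCoeff]
  simp only [map_zero, mul_zero, integral_zero] at h4
  have h5 := (integral_eq_zero_iff_of_nonneg_ae
    ((ae_add_pos hf hg hmin).mono fun t ht => by positivity) h3).1 (by exact_mod_cast h4.symm)
  have h6 : futureSeries c = 0 := by
    refine (Lp.eq_zero_iff_ae_eq_zero).2 ?_
    filter_upwards [h5, ae_add_pos hf hg hmin] with t h6 h7
    simpa [h7.ne'] using h6
  refine Subtype.ext ?_
  exact futureSeries.injective (by rw [h6]; simp)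

/-! ### Canonical factorization -/

theorem summable_norm_mul_pow (ψ : Ell2) {z : ℂ} (hz : ‖z‖ < 1) :
    Summable fun k => ‖ψ k * z ^ k‖ := by
  refine Summable.of_nonneg_of_le (fun k => norm_nonneg _) (fun k => ?_)
    ((summable_geometric_of_lt_one (norm_nonneg z) hz).mul_left ‖ψ‖)
  rw [norm_mul, norm_pow]
  exact mul_le_mul_of_nonneg_right (lp.norm_apply_le_norm (by norm_num) ψ k) (by positivity)

/-- The Cauchy product minus 1 is a power series that vanishes near 0, hence all its coefficients
vanish. -/
theorem sum_antidiagonal_of_reciprocal {ψ θ : Ell2}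
    (h : ∀ z : ℂ, ‖z‖ < 1 → (∑' k : ℕ, ψ k * z ^ k) * (∑' k : ℕ, θ k * z ^ k) = 1) (n : ℕ) :
    ∑ kl ∈ Finset.HasAntidiagonal.antidiagonal n, ψ kl.1 * θ kl.2 = if n = 0 then 1 else 0 := by
  set d : ℕ → ℂ := fun n =>
    (∑ kl ∈ Finset.HasAntidiagonal.antidiagonal n, ψ kl.1 * θ kl.2) - if n = 0 then 1 else 0 with hd
  have hs : HasFPowerSeriesAt (0 : ℂ → ℂ) (FormalMultilinearSeries.ofScalars ℂ d) 0 := by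
    rw [hasFPowerSeriesAt_iff]
    filter_upwards [Metric.ball_mem_nhds (0 : ℂ) one_pos] with z hz
    rw [mem_ball_zero_iff] at hz
    have h1 := summable_norm_mul_pow ψ hz
    have h2 := summable_norm_mul_pow θ hz
    have h3 := (summable_norm_sum_mul_antidiagonal_of_summable_norm h1 h2).of_norm.hasSum
    rw [← tsum_mul_tsum_eq_tsum_sum_antidiagonal_of_summable_norm h1 h2, h z hz] at h3
    have h4 := h3.sub (hasSum_ite_eq (0 : ℕ) (1 : ℂ))
    rw [sub_self] at h4
    rw [Pi.zero_apply]
    convert h4 using 2 with n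
    rw [FormalMultilinearSeries.coeff_ofScalars, hd, smul_eq_mul, mul_sub, Finset.mul_sum]
    congr 1
    · refine Finset.sum_congr rfl fun kl hkl => ?_
      rw [← Finset.HasAntidiagonal.mem_antidiagonal.1 hkl, pow_add]; ring
    · by_cases hn : n = 0 <;> simp [hn]
  have h5 := congrArg (fun p => FormalMultilinearSeries.coeff p n) hs.eq_zero
  simp only [FormalMultilinearSeries.coeff_ofScalars] at h5
  exact sub_eq_zero.1 (by simpa [FormalMultilinearSeries.coeff] using h5)

/-- Carries the reciprocity from the disc to the circle. The product of the boundary functions is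
integrable, and its Fourier coefficients are those of the Cauchy product, so uniqueness in L₁
applies. -/
theorem pastSeries_mul_eq_one {ψ θ : Ell2}
    (h : ∀ z : ℂ, ‖z‖ < 1 → (∑' k : ℕ, ψ k * z ^ k) * (∑' k : ℕ, θ k * z ^ k) = 1) :
    ∀ᵐ t ∂dm, pastSeries ψ t * pastSeries θ t = 1 := by
  have hi : Integrable (fun t => pastSeries ψ t * pastSeries θ t) dm :=
    (Lp.memLp (pastSeries ψ)).integrable_mul (Lp.memLp (pastSeries θ))
  refine ae_eq_of_fourierCoeff hi (integrable_const 1) fun n => ?_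
  have hs := hasSum_fourierCoeff_expSeries_mul inj_neg ψ (Lp.memLp (pastSeries θ)) n
  rw [fourierCoeff_one]
  refine hs.unique ?_
  rcases lt_or_ge 0 n with hn | hn
  · rw [if_neg hn.ne']
    convert hasSum_zero using 2 with k
    rw [fourierCoeff_pastSeries_of_pos _ (by omega), mul_zero]
  · obtain ⟨N, rfl⟩ : ∃ N : ℕ, n = -(N : ℤ) := ⟨(-n).toNat, by omega⟩
    have h1 : (if -(N : ℤ) = 0 then (1 : ℂ) else 0) = if N = 0 then 1 else 0 := by simp
    rw [h1, ← sum_antidiagonal_of_reciprocal h N,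
      Finset.Nat.sum_antidiagonal_eq_sum_range_succ (fun i j => ψ i * θ j)]
    convert hasSum_sum_of_ne_finset_zero (s := Finset.range N.succ) fun k hk => ?_ using 1
    · refine Finset.sum_congr rfl fun k hk => ?_
      rw [Finset.mem_range] at hk
      rw [← fourierCoeff_pastSeries θ (N - k)]
      congr 2
      omega
    · rw [Finset.mem_range] at hk
      rw [fourierCoeff_pastSeries_of_pos _ (by omega), mul_zero]
    · infer_instance

/-- Multiplication by the past series of θ, followed by restriction to positive frequencies, is Θ'.
The conjugate series gives conj Θ in the next lemma. -/
theorem matVec_transpose_lowerToeplitz (θ x : Ell2) (k : ℕ) :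
    matVec (lowerToeplitz θ).transpose x k =
      fourierCoeff (fun t => futureSeries x t * pastSeries θ t) ((k : ℤ) + 1) := by
  refine Eq.trans ?_
    (hasSum_fourierCoeff_expSeries_mul inj_succ x (Lp.memLp (pastSeries θ)) _).tsum_eq
  refine tsum_congr fun j => ?_
  rw [Matrix.transpose_apply, lowerToeplitz, mul_comm]
  congr 1
  split_ifs with h
  · rw [← fourierCoeff_pastSeries]; congr 1; omega
  · rw [fourierCoeff_pastSeries_of_pos]; omega

theorem matVec_conj_lowerToeplitz (θ z : Ell2) (k : ℕ) :
    matVec ((lowerToeplitz θ).map conj) z k =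
      fourierCoeff (fun t => futureSeries z t * conj (pastSeries θ t)) ((k : ℤ) + 1) := by
  refine Eq.trans ?_ (hasSum_fourierCoeff_expSeries_mul inj_succ z
    (memLp_conj (Lp.memLp (pastSeries θ))) _).tsum_eq
  refine tsum_congr fun j => ?_
  rw [Matrix.map_apply, lowerToeplitz, mul_comm, fourierCoeff_conj]
  congr 2
  split_ifs with h
  · rw [← fourierCoeff_pastSeries]; congr 1; omega
  · rw [fourierCoeff_pastSeries_of_pos]; omega

theorem fourierCoeff_mul_eq_zero {u v : Freq → ℂ} (hu : FreqGE 0 fun t => conj (u t))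
    (hv : FreqGE 0 fun t => conj (v t)) (huv : Integrable (fun t => u t * v t) dm) {n : ℤ}
    (hn : 0 < n) : fourierCoeff (fun t => u t * v t) n = 0 := by
  have h := (freqGE_mul hu hv (by simpa using integrable_conj huv)).2 (-n) (by omega)
  simp only [← map_mul] at h
  rw [fourierCoeff_conj, neg_neg] at h
  simpa using h

/-- Wiener–Hopf argument. With capitals for the series, P y = x means that X - YΨ conj Ψ has
spectrum in (-∞, 0]. Multiplication by Θ preserves this and gives XΘ - Z with Z = Y conj Ψ, whose
spectrum lies in [1, ∞). Hence Z is the positive part of XΘ, that is z = Θ'x, and Y = Z conj Θ. The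
converse multiplies back by Ψ. -/
theorem opP_eq_iff_of_factorization (hf : IsSpectralDensity f) (hg : IsSpectralDensity g)
    {ψ θ : Ell2} (hF : IsCanonicalFactorization (fun t => f t + g t) ψ θ) (x y : Ell2) :
    (∃ hy : y ∈ (opP f g).domain, opP f g ⟨y, hy⟩ = x) ↔
      (Memℓp (matVec (lowerToeplitz θ).transpose x) 2 ∧
        matVec ((lowerToeplitz θ).map conj) (matVec (lowerToeplitz θ).transpose x) = y) := by
  have hone := pastSeries_mul_eq_one hF.reciprocal
  have hw : ∀ᵐ t ∂dm, ((1 / (f t + g t) : ℝ) : ℂ) = pastSeries ψ t * conj (pastSeries ψ t) := by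
    filter_upwards [hF.eq_psi] with t ht
    rw [ht, Complex.mul_conj']; push_cast; rfl
  have hX := Lp.memLp (futureSeries x)
  have hΘ := Lp.memLp (pastSeries θ)
  have hΨ := Lp.memLp (pastSeries ψ)
  have hXΘ : Integrable (fun t => futureSeries x t * pastSeries θ t) dm := hX.integrable_mul hΘ
  have hXi := (freqGE_futureSeries x).1
  rw [opP_eq_iff]
  constructor
  · rintro ⟨hYw, hcoef⟩
    obtain ⟨hsq, -⟩ := integrable_sq_div hf hg hX hYw fun l => by
      rw [hcoef, fourierCoeff_futureSeries]
    have hY := Lp.memLp (futureSeries y)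
    have hZ1 : FreqGE 1 (fun t => futureSeries y t * conj (pastSeries ψ t)) := by
      simpa using freqGE_mul (freqGE_futureSeries y) (freqGE_conj_pastSeries ψ)
        (hY.integrable_mul (memLp_conj hΨ))
    -- Here the a priori estimate is indispensable: |Y conj Ψ|² = |Y|²/(f+g), while a product of two
    -- L₂ functions is in general only integrable.
    have hZ2 : MemLp (fun t => futureSeries y t * conj (pastSeries ψ t)) 2 dm := by
      refine (memLp_two_iff_integrable_sq_norm hZ1.1.1).2 (hsq.congr ?_)
      filter_upwards [hF.eq_psi] with t ht
      rw [ht, norm_mul, RCLike.norm_conj, mul_pow]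
    let z : Ell2 := ⟨_, memℓp_fourierCoeff hZ2 inj_succ⟩
    have hZ : (fun t => futureSeries y t * conj (pastSeries ψ t)) =ᵐ[dm] futureSeries z :=
      hZ1.eq_futureSeries fun k => rfl
    have hN : FreqGE 0 (fun t => conj (futureSeries x t -
        futureSeries y t * ((1 / (f t + g t) : ℝ) : ℂ))) :=
      freqGE_conj (hXi.sub hYw) fun n hn => by
        obtain ⟨k, rfl⟩ : ∃ k : ℕ, n = (k : ℤ) + 1 := ⟨(n - 1).toNat, by omega⟩
        rw [fourierCoeff_sub hXi hYw, hcoef, fourierCoeff_futureSeries, sub_self]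
    have hΘN : (fun t => pastSeries θ t * (futureSeries x t -
        futureSeries y t * ((1 / (f t + g t) : ℝ) : ℂ))) =ᵐ[dm]
        fun t => futureSeries x t * pastSeries θ t - futureSeries z t := by
      filter_upwards [hone, hw, hZ] with t h1 h2 h3
      rw [h2, ← h3]
      linear_combination (-(futureSeries y t * conj (pastSeries ψ t))) * h1
    have hz : matVec (lowerToeplitz θ).transpose x = z := by
      funext k
      have h1 := fourierCoeff_mul_eq_zero (freqGE_conj_pastSeries θ) hN
        ((hXΘ.sub (freqGE_futureSeries z).1).congr hΘN.symm) (n := (k : ℤ) + 1) (by omega)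
      rw [fourierCoeff_congr_ae hΘN, fourierCoeff_sub hXΘ (freqGE_futureSeries z).1,
        fourierCoeff_futureSeries, sub_eq_zero] at h1
      rw [matVec_transpose_lowerToeplitz, h1]
    rw [hz]
    refine ⟨lp.memℓp z, ?_⟩
    funext k
    rw [matVec_conj_lowerToeplitz, ← fourierCoeff_futureSeries]
    refine congrFun (fourierCoeff_congr_ae ?_) _
    filter_upwards [hone, hZ] with t h1 h2
    rw [← h2]
    have h3 := congrArg conj h1
    rw [map_mul, map_one] at h3
    linear_combination (futureSeries y t) * h3
  · rintro ⟨hmem, hy⟩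
    let z : Ell2 := ⟨_, hmem⟩
    have hz : ∀ k, z k = fourierCoeff (fun t => futureSeries x t * pastSeries θ t) ((k : ℤ) + 1) :=
      matVec_transpose_lowerToeplitz θ x
    have hZ := Lp.memLp (futureSeries z)
    have hZi := (freqGE_futureSeries z).1
    have hY : (fun t => futureSeries z t * conj (pastSeries θ t)) =ᵐ[dm] futureSeries y := by
      have h1 : FreqGE 1 (fun t => futureSeries z t * conj (pastSeries θ t)) := by
        simpa using freqGE_mul (freqGE_futureSeries z) (freqGE_conj_pastSeries θ)
          (hZ.integrable_mul (memLp_conj hΘ))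
      refine h1.eq_futureSeries fun k => ?_
      rw [← matVec_conj_lowerToeplitz, ← hy]
    -- As Y/(f+g) = Z conj Θ · Ψ conj Ψ = ZΨ is a product of two L₂ functions, the integrability
    -- required in the domain of P comes for free.
    have hYw : (fun t => futureSeries z t * pastSeries ψ t) =ᵐ[dm]
        fun t => futureSeries y t * ((1 / (f t + g t) : ℝ) : ℂ) := by
      filter_upwards [hone, hw, hY] with t h1 h2 h3
      rw [h2, ← h3]
      have h4 := congrArg conj h1
      rw [map_mul, map_one] at h4
      linear_combination (-(futureSeries z t * pastSeries ψ t)) * h4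
    have hZΨ : Integrable (fun t => futureSeries z t * pastSeries ψ t) dm := hZ.integrable_mul hΨ
    have hN : FreqGE 0 (fun t => conj (futureSeries x t * pastSeries θ t - futureSeries z t)) :=
      freqGE_conj (hXΘ.sub hZi) fun n hn => by
        obtain ⟨k, rfl⟩ : ∃ k : ℕ, n = (k : ℤ) + 1 := ⟨(n - 1).toNat, by omega⟩
        rw [fourierCoeff_sub hXΘ hZi, fourierCoeff_futureSeries, hz, sub_self]
    have hΨN : (fun t => pastSeries ψ t * (futureSeries x t * pastSeries θ t - futureSeries z t))
        =ᵐ[dm] fun t => futureSeries x t - futureSeries z t * pastSeries ψ t := by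
      filter_upwards [hone] with t h1
      linear_combination (futureSeries x t) * h1
    refine ⟨hZΨ.congr hYw, fun l => ?_⟩
    have h1 := fourierCoeff_mul_eq_zero (freqGE_conj_pastSeries ψ) hN
      ((hXi.sub hZΨ).congr hΨN.symm) (n := (l : ℤ) + 1) (by omega)
    rw [fourierCoeff_congr_ae hΨN, fourierCoeff_sub hXi hZΨ, fourierCoeff_futureSeries,
      sub_eq_zero] at h1
    rw [← fourierCoeff_congr_ae hYw, ← h1]

end Weight

theorem inner_toLp {α : Type*} [MeasurableSpace α] {ν : Measure α} {u v : α → ℂ}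
    (hu : MemLp u 2 ν) (hv : MemLp v 2 ν) :
    inner ℂ (hu.toLp u) (hv.toLp v) = ∫ t, conj (u t) * v t ∂ν := by
  rw [L2.inner_def]
  refine integral_congr_ae ?_
  filter_upwards [hu.coeFn_toLp, hv.coeFn_toLp] with t h1 h2
  rw [h1, h2, RCLike.inner_apply, mul_comm]

/-! ### Solvability of P c = r_p for an essentially bounded f + g -/

section Weight

variable {f g : Freq → ℝ}

theorem memLp_fourier_mul_div (hf : IsSpectralDensity f) (hg : IsSpectralDensity g) (p : ℤ) :
    MemLp (fun t => fourier p t * ((f t / (f t + g t) : ℝ) : ℂ)) 2 dm := by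
  refine memLp_fourier_mul (MemLp.of_bound ?_ 1 ?_) p
  · exact (Complex.measurable_ofReal.comp_aemeasurable
      (hf.integrable.aemeasurable.div (aemeasurable_add hf hg))).aestronglyMeasurable
  · filter_upwards [hf.nonneg, hg.nonneg] with t h1 h2
    simp only [Pi.zero_apply] at h1 h2
    rw [Complex.norm_real, Real.norm_of_nonneg (div_nonneg h1 (add_nonneg h1 h2))]
    exact div_le_one_of_le₀ (by linarith) (add_nonneg h1 h2)

theorem vecR_apply (hf : IsSpectralDensity f) (hg : IsSpectralDensity g) (p : ℤ) (l : ℕ) :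
    vecR hf hg p l =
      fourierCoeff (fun t => fourier p t * ((f t / (f t + g t) : ℝ) : ℂ)) ((l : ℤ) + 1) := by
  rw [fourierCoeff_fourier_mul]
  change coefR f g _ _ = _
  unfold coefR fourierCoeff
  refine integral_congr_ae (ae_of_all _ fun t => ?_)
  simp only [smul_eq_mul]
  congr 3; ring

/-- With s = √(f+g), project e^{iλp} f/s onto the closed span V of e^{iλ(k+1)}/s. If D is the
projection, then C = sD solves the equation: the normal equations say that D/s = C/(f+g) and e^{iλp}
f/(f+g) have the same positive coefficients. -/
theorem exists_opP_eq_vecR (hf : IsSpectralDensity f) (hg : IsSpectralDensity g)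
    (hmin : Minimality f g) {K : ℝ} (hK : ∀ᵐ t ∂dm, f t + g t ≤ K) (p : ℤ) :
    ∃ c : Ell2, ∃ hc : c ∈ (opP f g).domain, opP f g ⟨c, hc⟩ = vecR hf hg p := by
  have hpos := ae_add_pos hf hg hmin
  set s : Freq → ℝ := fun t => √(f t + g t) with hs
  have hsm : AEMeasurable s dm := (aemeasurable_add hf hg).sqrt
  have hsC : AEStronglyMeasurable (fun t => (s t : ℂ)) dm :=
    (Complex.measurable_ofReal.comp_aemeasurable hsm).aestronglyMeasurable
  have hsiC : AEStronglyMeasurable (fun t => ((s t)⁻¹ : ℂ)) dm :=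
    (Complex.measurable_ofReal.comp_aemeasurable hsm).inv.aestronglyMeasurable
  have hss : ∀ᵐ t ∂dm, 0 < s t ∧ s t ^ 2 = f t + g t := by
    filter_upwards [hpos] with t ht
    exact ⟨Real.sqrt_pos.2 ht, Real.sq_sqrt ht.le⟩
  have h1 : MemLp (fun t => (s t : ℂ)) 2 dm := by
    refine (memLp_two_iff_integrable_sq_norm hsC).2
      ((hf.integrable.add hg.integrable).congr ?_)
    filter_upwards [hss] with t ht
    rw [Complex.norm_real, Real.norm_of_nonneg ht.1.le, ht.2, Pi.add_apply]
  have h2 : MemLp (fun t => ((s t)⁻¹ : ℂ)) 2 dm := by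
    refine (memLp_two_iff_integrable_sq_norm hsiC).2
      ((integrable_one_div_add hf hg hmin).congr ?_)
    filter_upwards [hss] with t ht
    rw [norm_inv, Complex.norm_real, Real.norm_of_nonneg ht.1.le, inv_pow, ht.2, one_div]
  have h3 : MemLp (fun t => fourier p t * ((f t : ℂ) * ((s t)⁻¹ : ℂ))) 2 dm := by
    have hm : AEStronglyMeasurable (fun t => (f t : ℂ) * ((s t)⁻¹ : ℂ)) dm :=
      hf.integrable.ofReal.1.mul hsiC
    refine memLp_fourier_mul ((memLp_two_iff_integrable_sq_norm hm).2
      (hf.integrable.mono (hm.norm.pow 2) ?_)) p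
    filter_upwards [hss, hf.nonneg, hg.nonneg] with t ht h4 h5
    simp only [Pi.zero_apply] at h4 h5
    rw [norm_pow, norm_norm, norm_mul, norm_inv, Complex.norm_real, Complex.norm_real, mul_pow,
      inv_pow, Real.norm_of_nonneg ht.1.le, ht.2, Real.norm_of_nonneg h4, ← div_eq_mul_inv,
      div_le_iff₀ (by rw [← ht.2]; exact pow_pos ht.1 2)]
    nlinarith
  let V : Submodule ℂ (Lp ℂ 2 dm) := (Submodule.span ℂ (Set.range fun k : ℕ =>
    (memLp_fourier_mul h2 ((k : ℤ) + 1)).toLp _)).topologicalClosure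
  have hVc : IsClosed (V : Set (Lp ℂ 2 dm)) := Submodule.isClosed_topologicalClosure _
  have : CompleteSpace V := hVc.completeSpace_coe
  have hgen : ∀ k : ℕ, (memLp_fourier_mul h2 ((k : ℤ) + 1)).toLp _ ∈ V := fun k =>
    Submodule.le_topologicalClosure _ (Submodule.subset_span ⟨k, rfl⟩)
  set D : Lp ℂ 2 dm := V.starProjection (h3.toLp _) with hD
  have hDV : D ∈ V := Submodule.starProjection_apply_mem _ _
  have hDm : MemLp D 2 dm := Lp.memLp D
  have hDeq : hDm.toLp D = D := Lp.toLp_coeFn _ _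
  -- Boundedness of f + g enters here, to place the coefficients of C in ℓ₂.
  have hC : MemLp (fun t => (s t : ℂ) * D t) 2 dm := by
    refine hDm.of_le_mul (c := √K) (hsC.mul hDm.1) ?_
    filter_upwards [hK] with t ht
    rw [norm_mul, Complex.norm_real, Real.norm_of_nonneg (Real.sqrt_nonneg _)]
    exact mul_le_mul_of_nonneg_right (Real.sqrt_le_sqrt ht) (norm_nonneg _)
  have hCF : FreqGE 1 (fun t => (s t : ℂ) * D t) := by
    refine ⟨integrable_of_memLp_two hC, fun n hn => ?_⟩
    -- The weights s and 1/s cancel in the inner product of s e^{inλ} with a generator of V, and n ≤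
    -- 0 never equals k + 1.
    have h4 : (memLp_fourier_mul h1 n).toLp _ ∈ Vᗮ := by
      rw [Submodule.orthogonal_closure, Submodule.mem_orthogonal]
      intro u hu
      induction hu using Submodule.span_induction with
      | zero => simp
      | add x y _ _ hx hy => rw [inner_add_left, hx, hy, add_zero]
      | smul a x _ hx => rw [inner_smul_left, hx, mul_zero]
      | mem x hx =>
        obtain ⟨k, rfl⟩ := hx
        rw [inner_toLp]
        have h5 := congrFun (fourierCoeff_fourier (T := 2 * π) n) ((k : ℤ) + 1)
        rw [Pi.single_apply, if_neg (by omega)] at h5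
        rw [← h5]
        refine integral_congr_ae ?_
        filter_upwards [hss] with t ht
        have h6 : (s t : ℂ) ≠ 0 := by exact_mod_cast ht.1.ne'
        rw [map_mul, map_inv₀, Complex.conj_ofReal, ← fourier_neg, smul_eq_mul]
        field_simp
    have h5 := (Submodule.mem_orthogonal' _ _).1 h4 D hDV
    rw [← hDeq, inner_toLp] at h5
    rw [← h5]
    refine integral_congr_ae (ae_of_all _ fun t => ?_)
    simp only [map_mul, Complex.conj_ofReal, fourier_neg, smul_eq_mul, mul_assoc]
  let c : Ell2 := ⟨_, memℓp_fourierCoeff hC inj_succ⟩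
  have hcC : (fun t => (s t : ℂ) * D t) =ᵐ[dm] futureSeries c := hCF.eq_futureSeries fun k => rfl
  have hcw : (fun t => ((s t)⁻¹ : ℂ) * D t) =ᵐ[dm]
      fun t => futureSeries c t * ((1 / (f t + g t) : ℝ) : ℂ) := by
    filter_upwards [hcC, hss] with t h4 h5
    have h6 : (s t : ℂ) ≠ 0 := by exact_mod_cast h5.1.ne'
    rw [← h4, ← h5.2]
    push_cast
    field_simp
  refine ⟨c, (opP_eq_iff _ _).2 ⟨(h2.integrable_mul hDm).congr hcw, fun l => ?_⟩⟩
  have h4 := Submodule.starProjection_inner_eq_zero (K := V) (h3.toLp _) _ (hgen l)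
  rw [← hD, inner_eq_zero_symm, inner_sub_right, sub_eq_zero, inner_toLp, ← hDeq,
    inner_toLp] at h4
  rw [← fourierCoeff_congr_ae hcw, vecR_apply]
  refine Eq.trans ?_ (h4.symm.trans ?_)
  · refine integral_congr_ae (ae_of_all _ fun t => ?_)
    simp only [map_mul, map_inv₀, Complex.conj_ofReal, fourier_neg, smul_eq_mul, mul_assoc]
  · refine integral_congr_ae ?_
    filter_upwards [hss] with t h5
    have h6 : (s t : ℂ) ≠ 0 := by exact_mod_cast h5.1.ne'
    simp only [map_mul, map_inv₀, Complex.conj_ofReal, fourier_neg, smul_eq_mul]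
    rw [← h5.2]
    push_cast
    field_simp

/-! ### The spectral measure -/

theorem ae_lt_top_ofReal (F : Freq → ℝ) : ∀ᵐ t ∂dm, ENNReal.ofReal (F t) < ∞ :=
  ae_of_all _ fun _ => ENNReal.ofReal_lt_top

theorem IsSpectralDensity.integral_spectralMeasure {F : Freq → ℝ} (hF : IsSpectralDensity F)
    (h : Freq → ℂ) : ∫ t, h t ∂(spectralMeasure F) = ∫ t, (F t : ℂ) * h t ∂dm := by
  unfold spectralMeasure
  rw [integral_withDensity_eq_integral_toReal_smul₀ hF.integrable.aemeasurable.ennreal_ofReal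
    (ae_lt_top_ofReal F)]
  refine integral_congr_ae ?_
  filter_upwards [hF.nonneg] with t ht
  rw [ENNReal.toReal_ofReal ht, Complex.real_smul]

theorem IsSpectralDensity.integrable_spectralMeasure_iff {F : Freq → ℝ} (hF : IsSpectralDensity F)
    {E : Type*} [NormedAddCommGroup E] [NormedSpace ℝ E] {h : Freq → E} :
    Integrable h (spectralMeasure F) ↔ Integrable (fun t => F t • h t) dm := by
  unfold spectralMeasure
  rw [integrable_withDensity_iff_integrable_smul₀' hF.integrable.aemeasurable.ennreal_ofReal
    (ae_lt_top_ofReal F)]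
  refine integrable_congr ?_
  filter_upwards [hF.nonneg] with t ht
  rw [ENNReal.toReal_ofReal ht]

theorem IsSpectralDensity.isFiniteMeasure {F : Freq → ℝ} (hF : IsSpectralDensity F) :
    IsFiniteMeasure (spectralMeasure F) := by
  have : Integrable (fun _ : Freq => (1 : ℝ)) (spectralMeasure F) := by
    rw [hF.integrable_spectralMeasure_iff]; simpa using hF.integrable
  exact ((integrable_const_iff).1 this).resolve_left one_ne_zero

theorem IsSpectralDensity.add (hf : IsSpectralDensity f) (hg : IsSpectralDensity g) :
    IsSpectralDensity fun t => f t + g t :=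
  ⟨hf.integrable.add hg.integrable, by
    filter_upwards [hf.nonneg, hg.nonneg] with t h1 h2 using add_nonneg h1 h2⟩

theorem IsSpectralDensity.memLp_fourier {F : Freq → ℝ} (hF : IsSpectralDensity F) (m : ℤ) :
    MemLp (fourier m) 2 (spectralMeasure F) := by
  have := hF.isFiniteMeasure
  exact MemLp.of_bound (map_continuous _).aestronglyMeasurable 1
    (ae_of_all _ fun t => (norm_fourier_apply m t).le)

/-- The function `e^{imλ}` as an element of `L₂(F dλ / 2π)`. -/
def expLp {F : Freq → ℝ} (hF : IsSpectralDensity F) (m : ℤ) : Lp ℂ 2 (spectralMeasure F) :=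
  (hF.memLp_fourier m).toLp _

theorem inner_expLp {F : Freq → ℝ} (hF : IsSpectralDensity F) (m : ℤ) {φ : Freq → ℂ}
    (hφ : MemLp φ 2 (spectralMeasure F)) :
    inner ℂ (expLp hF m) (hφ.toLp φ) = fourierCoeff (fun t => (F t : ℂ) * φ t) m := by
  unfold expLp
  rw [inner_toLp, hF.integral_spectralMeasure]
  refine integral_congr_ae (ae_of_all _ fun t => ?_)
  simp only [fourier_neg, smul_eq_mul]
  ring

/-- An element of `L₂(F dλ / 2π)`, integrable and with spectrum in `(-∞, 0]`, is a limit of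
trigonometric polynomials in `e^{imλ}`, `m ≤ 0`. -/
theorem toLp_mem_closure_span {F : Freq → ℝ} (hF : IsSpectralDensity F) {φ : Freq → ℂ}
    (hφ : MemLp φ 2 (spectralMeasure F)) (hφ0 : FreqGE 0 fun t => conj (φ t)) :
    hφ.toLp φ ∈ (Submodule.span ℂ (expLp hF '' {m : ℤ | m ≤ 0})).topologicalClosure := by
  have := hF.isFiniteMeasure
  -- By duality it suffices to test against u orthogonal to all e^{imλ}, m ≤ 0. Then F u has
  -- spectrum in [1, ∞), conj φ has spectrum in [0, ∞), and their integrable product has mean zero.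
  rw [← Submodule.orthogonal_orthogonal_eq_closure, Submodule.mem_orthogonal]
  intro u hu
  have hum := Lp.memLp u
  have hueq : hum.toLp u = u := Lp.toLp_coeFn _ _
  have hU : FreqGE 1 (fun t => (F t : ℂ) * u t) := by
    refine ⟨?_, fun n hn => ?_⟩
    · have := hF.integrable_spectralMeasure_iff.1 (hum.integrable (by norm_num))
      exact this.congr (ae_of_all _ fun t => by simp)
    · rw [← inner_expLp hF n hum, hueq]
      exact (Submodule.mem_orthogonal _ _).1 hu _
        (Submodule.subset_span ⟨n, show n ≤ 0 by omega, rfl⟩)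
  have hi : Integrable (fun t => (F t : ℂ) * u t * conj (φ t)) dm := by
    have h1 : MemLp (fun t => conj (φ t)) 2 (spectralMeasure F) :=
      hφ.of_le (Complex.continuous_conj.comp_aestronglyMeasurable hφ.1)
        (ae_of_all _ fun t => by simp)
    have := hF.integrable_spectralMeasure_iff.1 (hum.integrable_mul h1)
    exact this.congr (ae_of_all _ fun t => by simp [mul_assoc])
  have h := congrArg conj (integral_mul_eq_zero_of_freqGE hU hφ0 hi)
  rw [map_zero, ← integral_conj] at h
  rw [← hueq, inner_toLp, hF.integral_spectralMeasure, ← h]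
  refine integral_congr_ae (ae_of_all _ fun t => ?_)
  simp only [map_mul, Complex.conj_ofReal, Complex.conj_conj, mul_assoc]

end Weight

/-! ### Transfer along an isometry -/

section Transfer

variable {ι H H' : Type*} [NormedAddCommGroup H] [InnerProductSpace ℂ H]
  [NormedAddCommGroup H'] [InnerProductSpace ℂ H']

theorem inner_linearCombination_eq {e : ι → H} {ζ : ι → H'}
    (h : ∀ m k, inner ℂ (ζ m) (ζ k) = inner ℂ (e m) (e k)) (q r : ι →₀ ℂ) :
    inner ℂ (Finsupp.linearCombination ℂ ζ q) (Finsupp.linearCombination ℂ ζ r) =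
      inner ℂ (Finsupp.linearCombination ℂ e q) (Finsupp.linearCombination ℂ e r) := by
  simp only [Finsupp.linearCombination_apply, Finsupp.sum, sum_inner, inner_sum, inner_smul_left,
    inner_smul_right, h]

theorem norm_linearCombination_eq {e : ι → H} {ζ : ι → H'}
    (h : ∀ m k, inner ℂ (ζ m) (ζ k) = inner ℂ (e m) (e k)) (q : ι →₀ ℂ) :
    ‖Finsupp.linearCombination ℂ ζ q‖ = ‖Finsupp.linearCombination ℂ e q‖ := by
  rw [norm_eq_sqrt_re_inner (𝕜 := ℂ), norm_eq_sqrt_re_inner (𝕜 := ℂ),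
    inner_linearCombination_eq h]

/-- Equal Gram matrices make linear combinations with the same coefficients equally long, so
coefficients approximating x give a Cauchy sequence in H'. Its limit y is the image of x under the
isometry. The common coefficients q are kept because they witness the spectral integral. -/
theorem exists_tendsto_linearCombination [CompleteSpace H'] {e : ι → H} {ζ : ι → H'}
    (h : ∀ m k, inner ℂ (ζ m) (ζ k) = inner ℂ (e m) (e k)) {s : Set ι} {x : H}
    (hx : x ∈ (Submodule.span ℂ (e '' s)).topologicalClosure) :
    ∃ (q : ℕ → ι →₀ ℂ) (y : H'),
      Tendsto (fun n => Finsupp.linearCombination ℂ e (q n)) atTop (𝓝 x) ∧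
      Tendsto (fun n => Finsupp.linearCombination ℂ ζ (q n)) atTop (𝓝 y) ∧
      y ∈ (Submodule.span ℂ (ζ '' s)).topologicalClosure ∧
      (∀ m, inner ℂ (ζ m) y = inner ℂ (e m) x) ∧ ‖y‖ = ‖x‖ := by
  obtain ⟨v, hv, hlim⟩ := mem_closure_iff_seq_limit.1 hx
  choose q hq hqv using fun n => (Finsupp.mem_span_image_iff_linearCombination ℂ).1 (hv n)
  have h1 : Tendsto (fun n => Finsupp.linearCombination ℂ e (q n)) atTop (𝓝 x) := by
    simpa only [hqv] using hlim
  have hc : CauchySeq fun n => Finsupp.linearCombination ℂ ζ (q n) := by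
    have h2 := h1.cauchySeq
    rw [Metric.cauchySeq_iff] at h2 ⊢
    intro ε hε
    obtain ⟨N, hN⟩ := h2 ε hε
    refine ⟨N, fun m hm n hn => ?_⟩
    rw [dist_eq_norm, ← map_sub, norm_linearCombination_eq h, map_sub, ← dist_eq_norm]
    exact hN m hm n hn
  obtain ⟨y, hy⟩ := cauchySeq_tendsto_of_complete hc
  refine ⟨q, y, h1, hy, ?_, fun m => ?_, ?_⟩
  · exact mem_closure_of_tendsto hy (Eventually.of_forall fun n =>
      (Finsupp.mem_span_image_iff_linearCombination ℂ).2 ⟨q n, hq n, rfl⟩)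
  · refine tendsto_nhds_unique ((tendsto_const_nhds (x := ζ m)).inner (𝕜 := ℂ) hy)
      (((tendsto_const_nhds (x := e m)).inner (𝕜 := ℂ) h1).congr fun n => ?_)
    have := inner_linearCombination_eq h (Finsupp.single m 1) (q n)
    simpa using this.symm
  · exact tendsto_nhds_unique hy.norm (h1.norm.congr fun n => (norm_linearCombination_eq h _).symm)

end Transfer

/-! ### The optimal estimate and its mean-square error -/

section Estimate

variable {Ω : Type*} [MeasurableSpace Ω] {μ : Measure Ω}

theorem inner_eq_integral (X Y : Lp ℂ 2 μ) : inner ℂ X Y = ∫ ω, Y ω * conj (X ω) ∂μ := by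
  rw [L2.inner_def]
  rfl

theorem norm_sq_eq_integral {α : Type*} [MeasurableSpace α] {ν : Measure α} (X : Lp ℂ 2 ν) :
    ‖X‖ ^ 2 = ∫ ω, ‖X ω‖ ^ 2 ∂ν := by
  have h := inner_self_eq_norm_sq_to_K (𝕜 := ℂ) X
  rw [L2.inner_def] at h
  simp only [inner_self_eq_norm_sq_to_K] at h
  have h2 : ∫ ω, ((‖X ω‖ ^ 2 : ℝ) : ℂ) ∂ν = ((‖X‖ ^ 2 : ℝ) : ℂ) := by
    push_cast
    exact h
  rw [integral_complex_ofReal] at h2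
  exact_mod_cast h2.symm

theorem mse_eq_norm_sq (X Y : Lp ℂ 2 μ) : mse μ X Y = ‖X - Y‖ ^ 2 := by
  rw [norm_sq_eq_integral]
  refine integral_congr_ae ?_
  filter_upwards [Lp.coeFn_sub X Y] with ω h
  rw [h, Pi.sub_apply]

/-- Orthogonality extends from the generators to their closed span, and Pythagoras then gives
optimality and uniqueness together. -/
theorem isOptimalEstimate_of_inner_eq_zero {ζ : ℤ → Lp ℂ 2 μ} {X Y : Lp ℂ 2 μ}
    (hY : Y ∈ pastSpace μ ζ) (h : ∀ m ≤ 0, inner ℂ (ζ m) (X - Y) = 0) :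
    (∀ Y' ∈ pastSpace μ ζ, inner ℂ Y' (X - Y) = 0) ∧ IsOptimalEstimate μ ζ X Y ∧
      ∀ Y', IsOptimalEstimate μ ζ X Y' → Y' = Y := by
  have h1 : ∀ Y' ∈ pastSpace μ ζ, inner ℂ Y' (X - Y) = 0 := by
    have h2 : X - Y ∈ (pastSpace μ ζ)ᗮ := by
      unfold pastSpace
      rw [Submodule.orthogonal_closure, Submodule.mem_orthogonal]
      intro u hu
      induction hu using Submodule.span_induction with
      | zero => simp
      | add x y _ _ hx hy => rw [inner_add_left, hx, hy, add_zero]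
      | smul a x _ hx => rw [inner_smul_left, hx, mul_zero]
      | mem x hx =>
        obtain ⟨m, hm, rfl⟩ := hx
        exact h m hm
    exact fun Y' hY' => (Submodule.mem_orthogonal _ _).1 h2 Y' hY'
  have h3 : ∀ Y' ∈ pastSpace μ ζ, mse μ X Y' = mse μ X Y + ‖Y' - Y‖ ^ 2 := by
    intro Y' hY'
    have h4 := h1 (Y' - Y) ((pastSpace μ ζ).sub_mem hY' hY)
    have h5 := norm_sub_sq (𝕜 := ℂ) (X - Y) (Y' - Y)
    rw [inner_eq_zero_symm.1 h4, sub_sub_sub_cancel_right] at h5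
    rw [mse_eq_norm_sq, mse_eq_norm_sq, h5]
    simp
  refine ⟨h1, ⟨hY, fun Y' hY' => ?_⟩, fun Y' hY' => ?_⟩
  · rw [h3 Y' hY']
    exact le_add_of_nonneg_right (sq_nonneg _)
  · have h4 := hY'.2 Y hY
    rw [h3 Y' hY'.1] at h4
    have h5 : ‖Y' - Y‖ ^ 2 = 0 := le_antisymm (by linarith) (sq_nonneg _)
    exact sub_eq_zero.1 (norm_eq_zero.1 (pow_eq_zero_iff two_ne_zero |>.1 h5))

theorem inner_add_stationary {ξ η : ℤ → Lp ℂ 2 μ} {f g : Freq → ℝ}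
    (hξ : IsStationaryWithDensity μ ξ f) (hη : IsStationaryWithDensity μ η g)
    (hξη : Uncorrelated μ ξ η) (m k : ℤ) :
    inner ℂ (ξ m + η m) (ξ k) = fourierCoeff (fun t => fourier k t * (f t : ℂ)) m ∧
    inner ℂ (ξ m + η m) (ξ k + η k) =
      inner ℂ (expLp (hξ.density.add hη.density) m) (expLp (hξ.density.add hη.density) k) := by
  have hc : ∀ h : Freq → ℝ, ∫ t, fourier (k - m) t * (h t : ℂ) ∂dm =
      fourierCoeff (fun t => fourier k t * (h t : ℂ)) m := by
    intro h
    refine integral_congr_ae (ae_of_all _ fun t => ?_)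
    simp only [smul_eq_mul]
    rw [← mul_assoc, ← fourier_add]
    congr 3; ring
  have h1 : inner ℂ (ξ m) (ξ k) = fourierCoeff (fun t => fourier k t * (f t : ℂ)) m := by
    rw [inner_eq_integral, hξ.cov, hc]
  have h2 : inner ℂ (η m) (η k) = fourierCoeff (fun t => fourier k t * (g t : ℂ)) m := by
    rw [inner_eq_integral, hη.cov, hc]
  have h3 : ∀ m k, inner ℂ (η m) (ξ k) = 0 := fun m k => by rw [inner_eq_integral, hξη]
  refine ⟨by rw [inner_add_left, h1, h3, add_zero], ?_⟩
  rw [inner_add_left, inner_add_right, inner_add_right, h1, h2, h3,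
    inner_eq_zero_symm.1 (h3 k m), add_zero, zero_add]
  rw [show expLp (hξ.density.add hη.density) k =
    ((hξ.density.add hη.density).memLp_fourier k).toLp _ from rfl, inner_expLp]
  have h4 := congrFun (fourierCoeff.add
    (integrable_continuous_mul (map_continuous (fourier k)) hξ.density.integrable.ofReal)
    (integrable_continuous_mul (map_continuous (fourier k)) hη.density.integrable.ofReal)) m
  rw [Pi.add_apply] at h4
  refine h4.symm.trans (congrFun (fourierCoeff_congr_ae (ae_of_all _ fun t => ?_)) m)
  simp only [Pi.add_apply, Complex.ofReal_add]
  exact (mul_add _ _ _).symm.trans (mul_comm _ _)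

/-- The integrals in the mean-square error, reduced to `∫ |C|² / (f+g)`. -/
theorem error_identities {a C : ℂ} {f g : ℝ} (ha : ‖a‖ = 1) (hfg : 0 < f + g) :
    ‖a * g + C‖ ^ 2 / (f + g) ^ 2 * f + ‖a * f - C‖ ^ 2 / (f + g) ^ 2 * g =
        f * g / (f + g) + ‖C‖ ^ 2 * (1 / (f + g)) ∧
      (f + g) * ‖a * ((f / (f + g) : ℝ) : ℂ) - C / ((f + g : ℝ) : ℂ)‖ ^ 2 =
        f - f * g / (f + g) - 2 * (C * conj (a * ((f / (f + g) : ℝ) : ℂ))).re +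
          ‖C‖ ^ 2 * (1 / (f + g)) := by
  have h0 : ((f + g : ℝ) : ℂ) ≠ 0 := by exact_mod_cast hfg.ne'
  have h1 : a * ((f / (f + g) : ℝ) : ℂ) - C / ((f + g : ℝ) : ℂ) =
      (a * f - C) / ((f + g : ℝ) : ℂ) := by
    push_cast at h0 ⊢
    field_simp
  have h2 : (C * conj (a * ((f / (f + g) : ℝ) : ℂ))).re = (C * conj a).re * (f / (f + g)) := by
    rw [map_mul, Complex.conj_ofReal, ← mul_assoc, Complex.re_mul_ofReal]
  have ha' : a.re * a.re + a.im * a.im = 1 := by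
    rw [← Complex.normSq_apply, ← Complex.sq_norm, ha, one_pow]
  rw [h2, h1, norm_div, Complex.norm_real, Real.norm_of_nonneg hfg.le, div_pow]
  simp only [Complex.sq_norm, Complex.normSq_apply, Complex.add_re, Complex.add_im, Complex.sub_re,
    Complex.sub_im, Complex.mul_re, Complex.mul_im, Complex.ofReal_re, Complex.ofReal_im,
    Complex.conj_re, Complex.conj_im]
  -- In the first identity the cross terms in a conj C, weighted by gf and fg, cancel. The second
  -- uses f²/(f+g) = f - fg/(f+g).
  constructor
  · field_simp
    linear_combination (f * g * (f + g)) * ha'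
  · field_simp
    linear_combination (f ^ 2) * ha'

/-- Everything is computed for φ = G - C/(f+g) in L₂((f+g) dλ/2π), then transferred to L₂(Ω). Both
error formulas reduce to ∫ fg/(f+g) + ∫ |C|²/(f+g). -/
theorem exists_optimalEstimate {ξ η : ℤ → Lp ℂ 2 μ} {f g : Freq → ℝ}
    (hξ : IsStationaryWithDensity μ ξ f) (hη : IsStationaryWithDensity μ η g)
    (hξη : Uncorrelated μ ξ η) (hmin : Minimality f g) (p : ℤ) {c : Ell2}
    (hc : ∃ h : c ∈ (opP f g).domain, opP f g ⟨c, h⟩ = vecR hξ.density hη.density p) :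
    ∃ Y : Lp ℂ 2 μ,
      IsOptimalEstimate μ (fun m => ξ m + η m) (ξ p) Y ∧
      (∀ Y', IsOptimalEstimate μ (fun m => ξ m + η m) (ξ p) Y' → Y' = Y) ∧
      IsSpectralIntegral μ (fun m => ξ m + η m) (fun t => f t + g t) (specChar f g p c) Y ∧
      mse μ (ξ p) Y =
        (∫ t, ‖fourier p t * (g t : ℂ) + futureSeries c t‖ ^ 2 / (f t + g t) ^ 2 * f t ∂dm) +
        (∫ t, ‖fourier p t * (f t : ℂ) - futureSeries c t‖ ^ 2 / (f t + g t) ^ 2 * g t ∂dm) ∧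
      (mse μ (ξ p) Y : ℂ) = (∑' k, vecR hξ.density hη.density p k * conj (c k)) +
        coefQ f g (-p) (-p) := by
  have hf := hξ.density
  have hg := hη.density
  have hF := hf.add hg
  have hpos := ae_add_pos hf hg hmin
  have hG := memLp_fourier_mul_div hf hg p
  set G : Freq → ℂ := fun t => fourier p t * ((f t / (f t + g t) : ℝ) : ℂ) with hGdef
  set φ := specChar f g p c with hφdef
  have hC := Lp.memLp (futureSeries c)
  obtain ⟨hCw, hcoef⟩ := (opP_eq_iff _ _).1 hc
  simp only [vecR_apply] at hcoef
  obtain ⟨hsq, hCG⟩ := integrable_sq_div hf hg hG hCw hcoef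
  have hCGi : Integrable (fun t => futureSeries c t * conj (G t)) dm :=
    hC.integrable_mul (memLp_conj hG)
  have hfm := hf.integrable.aemeasurable
  have hgm := hg.integrable.aemeasurable
  have hCm := hC.1.aemeasurable
  have hem : AEMeasurable (fun t : Freq => fourier p t) dm :=
    (map_continuous (fourier p)).aemeasurable
  have hφw : ∀ t, φ t = G t - futureSeries c t * ((1 / (f t + g t) : ℝ) : ℂ) := by
    intro t
    simp only [hφdef, specChar, hGdef]
    push_cast
    ring
  have hfg : Integrable (fun t => f t * g t / (f t + g t)) dm := by
    refine hf.integrable.mono ((hfm.mul hgm).div (hfm.add hgm)).aestronglyMeasurable ?_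
    filter_upwards [hf.nonneg, hg.nonneg, hpos] with t h1 h2 h3
    simp only [Pi.zero_apply] at h1 h2
    rw [Real.norm_of_nonneg (by positivity), Real.norm_of_nonneg h1, div_le_iff₀ h3]
    nlinarith
  have hid := hpos.mono fun t ht =>
    error_identities (C := futureSeries c t) (norm_fourier_apply p t) ht
  -- the squared norm of the spectral characteristic
  have hφsq_eq : (fun t => (f t + g t) * ‖φ t‖ ^ 2) =ᵐ[dm] fun t => f t - f t * g t / (f t + g t) -
      2 * (futureSeries c t * conj (G t)).re + ‖futureSeries c t‖ ^ 2 * (1 / (f t + g t)) :=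
    hid.mono fun t ht => ht.2
  have hφsq : Integrable (fun t => (f t + g t) * ‖φ t‖ ^ 2) dm :=
    (((hf.integrable.sub hfg).sub (hCGi.re.const_mul 2)).add hsq).congr hφsq_eq.symm
  have hφint : ∫ t, (f t + g t) * ‖φ t‖ ^ 2 ∂dm = (∫ t, f t ∂dm) -
      (∫ t, f t * g t / (f t + g t) ∂dm) -
      ∫ t, ‖futureSeries c t‖ ^ 2 * (1 / (f t + g t)) ∂dm := by
    -- The cross term equals the quadratic term by the a priori identity, so -2 + 1 leaves a single
    -- -∫ |C|²/(f+g).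
    have h1 : ∫ t, (futureSeries c t * conj (G t)).re ∂dm =
        ∫ t, ‖futureSeries c t‖ ^ 2 * (1 / (f t + g t)) ∂dm := by
      have := integral_re (𝕜 := ℂ) hCGi
      simp only [RCLike.re_eq_complex_re] at this
      rw [this, hCG, Complex.ofReal_re]
    have h2 : Integrable (fun t => 2 * (futureSeries c t * conj (G t)).re) dm :=
      hCGi.re.const_mul 2
    have h3 : Integrable (fun t => f t - f t * g t / (f t + g t)) dm := hf.integrable.sub hfg
    have h4 : Integrable (fun t => f t - f t * g t / (f t + g t) -
        2 * (futureSeries c t * conj (G t)).re) dm := h3.sub h2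
    rw [integral_congr_ae hφsq_eq, integral_add h4 hsq, integral_sub h3 h2,
      integral_sub hf.integrable hfg, integral_const_mul, h1]
    ring
  have hφm : AEStronglyMeasurable φ dm := by
    have : AEStronglyMeasurable
      (fun t => G t - futureSeries c t * ((1 / (f t + g t) : ℝ) : ℂ)) dm := hG.1.sub hCw.1
    exact this.congr (ae_of_all _ fun t => (hφw t).symm)
  have hφL : MemLp φ 2 (spectralMeasure fun t => f t + g t) := by
    refine (memLp_two_iff_integrable_sq_norm
      (hφm.mono_ac (withDensity_absolutelyContinuous _ _))).2 ?_
    exact hF.integrable_spectralMeasure_iff.2 (by simpa only [smul_eq_mul] using hφsq)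
  -- The equation P c = r_p enters as the vanishing of the positive coefficients of φ.
  have hφ0 : FreqGE 0 fun t => conj (φ t) := by
    have h1 := freqGE_conj (a := 0) ((integrable_of_memLp_two hG).sub hCw) fun n hn => by
      obtain ⟨k, rfl⟩ : ∃ k : ℕ, n = (k : ℤ) + 1 := ⟨(n - 1).toNat, by omega⟩
      exact (fourierCoeff_sub (integrable_of_memLp_two hG) hCw _).trans
        (sub_eq_zero.2 (hcoef k).symm)
    refine h1.congr (ae_of_all _ fun t => ?_)
    simp only [hφw, Pi.sub_apply]
  obtain ⟨q, Y, hqφ, hqY, hYpast, hYinner, hYnorm⟩ := exists_tendsto_linearCombination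
    (fun m k => (inner_add_stationary hξ hη hξη m k).2) (toLp_mem_closure_span hF hφL hφ0)
  have horth : ∀ m ≤ 0, inner ℂ (ξ m + η m) (ξ p - Y) = 0 := by
    intro m hm
    have hefi : Integrable (fun t => fourier p t * (f t : ℂ)) dm :=
      integrable_continuous_mul (map_continuous _) hf.integrable.ofReal
    rw [inner_sub_right, hYinner, (inner_add_stationary hξ hη hξη m p).1, inner_expLp hF m hφL]
    -- The spectrum of C starts at 1, so C contributes nothing at indices m ≤ 0, and only the
    -- covariance with ξ(p) remains.
    have h1 : (fun t => ((f t + g t : ℝ) : ℂ) * φ t) =ᵐ[dm]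
        fun t => fourier p t * (f t : ℂ) - futureSeries c t := by
      filter_upwards [hpos] with t ht
      have h0 : (f t : ℂ) + g t ≠ 0 := by exact_mod_cast ht.ne'
      rw [hφw, hGdef]
      push_cast
      field_simp
    rw [fourierCoeff_congr_ae h1, fourierCoeff_sub hefi (freqGE_futureSeries c).1,
      (freqGE_futureSeries c).2 m (by omega), sub_zero, sub_self]
  obtain ⟨hperp, hopt, huniq⟩ := isOptimalEstimate_of_inner_eq_zero hYpast horth
  have hξnorm : ‖ξ p‖ ^ 2 = ∫ t, f t ∂dm := by
    have h1 := hξ.cov p p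
    rw [← inner_eq_integral, inner_self_eq_norm_sq_to_K] at h1
    simp only [sub_self, fourier_zero, one_mul] at h1
    rw [integral_complex_ofReal] at h1
    refine Complex.ofReal_injective ?_
    push_cast
    exact h1
  have hYn : ‖Y‖ ^ 2 = ∫ t, (f t + g t) * ‖φ t‖ ^ 2 ∂dm := by
    have h1 := inner_self_eq_norm_sq_to_K (𝕜 := ℂ) (hφL.toLp φ)
    rw [inner_toLp, hF.integral_spectralMeasure] at h1
    have h2 : ∀ t, ((f t + g t : ℝ) : ℂ) * (conj (φ t) * φ t) =
        (((f t + g t) * ‖φ t‖ ^ 2 : ℝ) : ℂ) := fun t => by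
      rw [Complex.conj_mul']; push_cast; ring
    simp only [h2] at h1
    rw [integral_complex_ofReal] at h1
    rw [hYnorm]
    refine Complex.ofReal_injective ?_
    rw [h1]
    push_cast
    rfl
  have hmse : mse μ (ξ p) Y = (∫ t, f t * g t / (f t + g t) ∂dm) +
      ∫ t, ‖futureSeries c t‖ ^ 2 * (1 / (f t + g t)) ∂dm := by
    -- Pythagoras: the error is ‖ξ(p)‖² - ‖Y‖².
    have h1 := norm_add_sq (𝕜 := ℂ) (ξ p - Y) Y
    rw [inner_eq_zero_symm.1 (hperp Y hYpast), sub_add_cancel, hξnorm, hYn, hφint] at h1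
    simp only [map_zero, mul_zero, add_zero] at h1
    rw [mse_eq_norm_sq]
    linarith
  refine ⟨Y, hopt, huniq, ⟨hφL, q, ?_, hqY⟩, ?_, ?_⟩
  · rw [Lp.tendsto_Lp_iff_tendsto_eLpNorm'] at hqφ
    refine hqφ.congr fun n => eLpNorm_congr_ae ?_
    have h1 : ⇑(Finsupp.linearCombination ℂ (expLp hF) (q n)) =ᵐ[spectralMeasure fun t => f t + g t]
        trigPoly (q n) := by
      have h2 : ∀ᵐ t ∂(spectralMeasure fun t => f t + g t), ∀ m ∈ (q n).support,
          (q n m • expLp hF m) t = q n m * fourier m t := by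
        refine (Finset.eventually_all _).2 fun m _ => ?_
        filter_upwards [Lp.coeFn_smul (q n m) (expLp hF m),
          (hF.memLp_fourier m).coeFn_toLp] with t h3 h4
        rw [h3, Pi.smul_apply, smul_eq_mul, expLp, h4]
      rw [Finsupp.linearCombination_apply]
      unfold Finsupp.sum
      filter_upwards [h2, Lp.coeFn_fun_finsetSum (q n).support fun m => q n m • expLp hF m]
        with t h3 h4
      rw [h4]
      exact Finset.sum_congr rfl h3
    filter_upwards [h1, hφL.coeFn_toLp] with t h2 h3
    rw [Pi.sub_apply, h2, h3]
  · have hI : Integrable (fun t => f t * g t / (f t + g t) +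
        ‖futureSeries c t‖ ^ 2 * (1 / (f t + g t))) dm := hfg.add hsq
    have hfC : AEMeasurable (fun t => (f t : ℂ)) dm :=
      Complex.measurable_ofReal.comp_aemeasurable hfm
    have hgC : AEMeasurable (fun t => (g t : ℂ)) dm :=
      Complex.measurable_ofReal.comp_aemeasurable hgm
    have hI1 : Integrable (fun t => ‖fourier p t * (g t : ℂ) + futureSeries c t‖ ^ 2 /
        (f t + g t) ^ 2 * f t) dm := by
      refine hI.mono (((((hem.mul hgC).add hCm).norm.pow_const 2).div
        ((hfm.add hgm).pow_const 2)).mul hfm).aestronglyMeasurable ?_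
      filter_upwards [hid, hf.nonneg, hg.nonneg] with t h1 h2 h3
      simp only [Pi.zero_apply] at h2 h3
      rw [← h1.1, Real.norm_of_nonneg (by positivity), Real.norm_of_nonneg (by positivity)]
      exact le_add_of_nonneg_right (by positivity)
    have hI2 : Integrable (fun t => ‖fourier p t * (f t : ℂ) - futureSeries c t‖ ^ 2 /
        (f t + g t) ^ 2 * g t) dm := by
      refine hI.mono (((((hem.mul hfC).sub hCm).norm.pow_const 2).div
        ((hfm.add hgm).pow_const 2)).mul hgm).aestronglyMeasurable ?_
      filter_upwards [hid, hf.nonneg, hg.nonneg] with t h1 h2 h3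
      simp only [Pi.zero_apply] at h2 h3
      rw [← h1.1, Real.norm_of_nonneg (by positivity), Real.norm_of_nonneg (by positivity)]
      exact le_add_of_nonneg_left (by positivity)
    rw [hmse, ← integral_add hfg hsq, ← integral_add hI1 hI2]
    exact integral_congr_ae (hid.mono fun t ht => ht.1.symm)
  · have hsum : HasSum (fun k => vecR hf hg p k * conj (c k))
        ((∫ t, ‖futureSeries c t‖ ^ 2 * (1 / (f t + g t)) ∂dm : ℝ) : ℂ) := by
      -- At frequency 0 the coefficients of conj G that meet c(k) have index -(k+1) and equal conj
      -- r_k. The sum is real, so conjugation gives ⟨r, c⟩.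
      have h1 := hasSum_fourierCoeff_expSeries_mul inj_succ c (memLp_conj hG) 0
      have h2 : fourierCoeff (fun t => expSeries (fun k => (k : ℤ) + 1) inj_succ c t *
          conj (G t)) 0 =
          ((∫ t, ‖futureSeries c t‖ ^ 2 * (1 / (f t + g t)) ∂dm : ℝ) : ℂ) := by
        rw [← hCG]
        simp [fourierCoeff, futureSeries]
      rw [h2] at h1
      have h3 := Complex.hasSum_conj'.2 h1
      rw [Complex.conj_ofReal] at h3
      convert h3 using 2 with k
      rw [fourierCoeff_conj, vecR_apply, map_mul, Complex.conj_conj, mul_comm]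
      congr 2
    rw [hmse, hsum.tsum_eq]
    have hQ : coefQ f g (-p) (-p) = ((∫ t, f t * g t / (f t + g t) ∂dm : ℝ) : ℂ) := by
      unfold coefQ
      simp only [sub_self, fourier_zero, one_mul]
      exact integral_complex_ofReal
    rw [hQ]
    push_cast
    ring

end Estimate

end NoisyFilter
end

open NoisyFilter

theorem mainTheorem3 {Ω : Type*} [MeasurableSpace Ω] (μ : Measure Ω) [IsProbabilityMeasure μ]
    (ξ η : ℤ → Lp ℂ 2 μ) (f g : Freq → ℝ)
    (hξ : IsStationaryWithDensity μ ξ f) (hη : IsStationaryWithDensity μ η g)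
    (hξη : Uncorrelated μ ξ η) (hmin : Minimality f g) (p : ℤ) (hp : p ≤ 0) :
    -- `P` is injective, so that `P⁻¹` is defined on the range of `P`
    LinearMap.ker (opP f g).toFun = ⊥ ∧
    -- `P⁻¹ r_p` exists whenever `f + g` is essentially bounded
    ((∃ K : ℝ, ∀ᵐ t ∂dm, f t + g t ≤ K) →
      vecR hξ.density hη.density p ∈ (opP f g).inverse.domain) ∧
    -- the optimal estimate, its spectral characteristic and its mean-square error
    (∀ hr : vecR hξ.density hη.density p ∈ (opP f g).inverse.domain,
      let r : Ell2 := vecR hξ.density hη.density p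
      let c : Ell2 := (opP f g).inverse ⟨r, hr⟩
      ∃ Y : Lp ℂ 2 μ,
        IsOptimalEstimate μ (fun m => ξ m + η m) (ξ p) Y ∧
        (∀ Y', IsOptimalEstimate μ (fun m => ξ m + η m) (ξ p) Y' → Y' = Y) ∧
        IsSpectralIntegral μ (fun m => ξ m + η m) (fun t => f t + g t) (specChar f g p c) Y ∧
        mse μ (ξ p) Y =
          (∫ t, ‖fourier p t * (g t : ℂ) + futureSeries c t‖ ^ 2 / (f t + g t) ^ 2 * f t ∂dm) +
          (∫ t, ‖fourier p t * (f t : ℂ) - futureSeries c t‖ ^ 2 / (f t + g t) ^ 2 * g t ∂dm) ∧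
        (mse μ (ξ p) Y : ℂ) = (∑' k, r k * conj (c k)) + coefQ f g (-p) (-p)) ∧
    -- if `f + g` admits the canonical factorization, then `P⁻¹ = conj Θ * Θᵀ`
    (∀ ψ θ : Ell2, IsCanonicalFactorization (fun t => f t + g t) ψ θ →
      ∀ x y : Ell2,
        (∃ hx : x ∈ (opP f g).inverse.domain, (opP f g).inverse ⟨x, hx⟩ = y) ↔
        (Memℓp (matVec (lowerToeplitz θ).transpose x) 2 ∧
          matVec ((lowerToeplitz θ).map conj) (matVec (lowerToeplitz θ).transpose x) = y)) := by
  have hf := hξ.density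
  have hg := hη.density
  have hker := ker_opP hf hg hmin
  refine ⟨hker, ?_, fun hr => ?_, fun ψ θ hF x y => ?_⟩
  · rintro ⟨K, hK⟩
    obtain ⟨c, hc⟩ := exists_opP_eq_vecR hf hg hmin hK p
    exact ((linearPMap_inverse_eq_iff hker _ c).2 hc).1
  · exact exists_optimalEstimate hξ hη hξη hmin p
      ((linearPMap_inverse_eq_iff hker _ _).1 ⟨hr, rfl⟩)
  · rw [linearPMap_inverse_eq_iff hker, opP_eq_iff_of_factorization hf hg hF]
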